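/- Let $K$ be a locally finite simplicial complex (every vertex lies in finitely many simplices), with polyhedron $|K|$ carrying the coherent topology, and let $\epsilon\in\mathcal{C}^0(K;\mathbb{Z}/2\mathbb{Z})$, i.e. a labelling of the vertices of $K$ by $0$ and $1$. Let $V_\epsilon$ be the subcomplex of the first barycentric subdivision $\mathrm{Sd}(K)$ dual to the cocycle $d\epsilon$: its simplices are the faces of the simplices $[\hat\sigma_0,\dots,\hat\sigma_i]$, where $\sigma_0<\dots<\sigma_i$ are simplices of $K$, each a proper face of the next, $\hat\sigma_j$ is the barycenter of $\sigma_j$, $\dim\sigma_0=1$ and $\langle d\epsilon,\sigma_0\rangle\neq 0$ (that is, the two vertices of $\sigma_0$ have different labels). (1) Let $\sigma$ be a simplex of $K$ with $V_\epsilon\cap\sigma\neq\emptyset$. Then there is an affine hyperplane that strictly separates the vertices of $\sigma$ labelled $1$ from those labelled $0$; and for every such hyperplane, with section $H_\sigma\subset\sigma$, the set $V_\epsilon\cap\sigma$ is isotopic to $H_\sigma$ within $\sigma$: there is a continuous family of homeomorphisms $(h_t)_{t\in[0,1]}$ of $\sigma$ with $h_0=\mathrm{id}$ and $h_1(V_\epsilon\cap\sigma)=H_\sigma$.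 (2) $V_\epsilon\subset |K|$ has the structure of a CW complex whose $p$-cells, for every $p\ge 0$, are in bijection with the $(p+1)$-simplices $\sigma$ of $K$ on which $\epsilon$ is not constant, the closed cell corresponding to $\sigma$ being $V_\epsilon\cap\sigma$. -/

import Mathlib

universe u

namespace Geometry.SimplicialComplex

variable {E : Type u} [AddCommGroup E] [Module ℝ E]

/-- Every vertex belongs to only finitely many simplices. -/
def IsLocallyFinite (K : SimplicialComplex ℝ E) : Prop :=
  ∀ v ∈ K.vertices, {σ ∈ K.faces | v ∈ σ}.Finite

/-- The `p`-simplices of `K`, each given by its set of `p + 1` vertices. -/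
abbrev Simplices (K : SimplicialComplex ℝ E) (p : ℕ) : Type u :=
  {σ : Finset E // σ ∈ K.faces ∧ σ.card = p + 1}

/-- Simplicial `p`-cochains with coefficients in `ℤ/2ℤ`. -/
abbrev Cochain (K : SimplicialComplex ℝ E) (p : ℕ) : Type u :=
  K.Simplices p → ZMod 2

open Classical in
/-- The facet of a `(p + 1)`-simplex opposite to one of its vertices. -/
noncomputable def facetOpposite (K : SimplicialComplex ℝ E) {p : ℕ} (σ : K.Simplices (p + 1))
    (v : {v : E // v ∈ σ.1}) : K.Simplices p :=
  ⟨σ.1.erase v.1, by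
    have hc : (σ.1.erase v.1).card = p + 1 := by
      rw [Finset.card_erase_of_mem v.2, σ.2.2]
      rfl
    exact ⟨K.down_closed σ.2.1 (Finset.erase_subset _ _)
      (Finset.card_pos.mp (by rw [hc]; exact Nat.succ_pos p)), hc⟩⟩

/-- The coboundary operator: the value on `σ` is the sum of the values on the facets of `σ`. -/
noncomputable def coboundary (K : SimplicialComplex ℝ E) {p : ℕ} (ε : K.Cochain p) : K.Cochain (p + 1) :=
  fun σ => ∑ v : {v : E // v ∈ σ.1}, ε (K.facetOpposite σ v)

/-- The barycenter of the simplex with vertex set `σ`. -/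
noncomputable def barycenter (σ : Finset E) : E :=
  σ.centroid ℝ id

/-- A flag of simplices of `K`, that is, a finite set of simplices which is totally ordered by
the face relation. The barycenters of the members of a nonempty flag are the vertices of a simplex
of the barycentric subdivision of `K`. -/
def IsFlag (K : SimplicialComplex ℝ E) (c : Finset (Finset E)) : Prop :=
  (c : Set (Finset E)) ⊆ K.faces ∧ IsChain (· ⊆ ·) (c : Set (Finset E))

open Classical in
/-- The vertex set of the simplex `[σ̂₀, …, σ̂ᵢ]` of the barycentric subdivision that is given by a
flag `σ₀ < ⋯ < σᵢ`. -/
noncomputable def flagSimplex (c : Finset (Finset E)) : Finset E :=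
  c.image barycenter

/-- The simplices of the subcomplex `V_ε` of the barycentric subdivision: the faces of those
simplices `[σ̂₀, …, σ̂ᵢ]`, with `σ₀ < ⋯ < σᵢ`, for which `σ₀` has dimension `p + 1` and
`⟨dε, σ₀⟩ ≠ 0`. -/
def dualSimplices (K : SimplicialComplex ℝ E) {p : ℕ} (ε : K.Cochain p) : Set (Finset E) :=
  {s | s.Nonempty ∧ ∃ c : Finset (Finset E), K.IsFlag c ∧
    (∃ σ₀ : K.Simplices (p + 1), σ₀.1 ∈ c ∧ (∀ τ ∈ c, σ₀.1 ⊆ τ) ∧ K.coboundary ε σ₀ ≠ 0) ∧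
    s ⊆ flagSimplex c}

/-- The set of points of `V_ε`, the union of its simplices. -/
def dualSpace (K : SimplicialComplex ℝ E) {p : ℕ} (ε : K.Cochain p) : Set E :=
  ⋃ s ∈ K.dualSimplices ε, convexHull ℝ (s : Set E)

/-- The labelling `ε` of the vertices is constant on the vertices of `σ`. -/
def IsConstOn (K : SimplicialComplex ℝ E) (ε : K.Cochain 0) (σ : Finset E) : Prop :=
  ∀ a b : K.Simplices 0, a.1 ⊆ σ → b.1 ⊆ σ → ε a = ε b

/-- The affine hyperplane `{f = 0}` (strictly) separates the vertices of `σ` labelled `1` from the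
vertices of `σ` labelled `0`. -/
def Separates (K : SimplicialComplex ℝ E) (ε : K.Cochain 0) (σ : Finset E) (f : E →ᵃ[ℝ] ℝ) :
    Prop :=
  ∀ (a : K.Simplices 0), ∀ v ∈ a.1, v ∈ σ → (ε a = 1 → 0 < f v) ∧ (ε a = 0 → f v < 0)

/-- The polyhedron `|K|` of `K`. Its topology is the coherent one, see below, which may be finer
than the one induced by `E`. -/
def Polyhedron (K : SimplicialComplex ℝ E) : Type u :=
  {x : E // x ∈ K.space}

/-- `V_ε` as a subset of the polyhedron of `K`. -/
def dualSubset (K : SimplicialComplex ℝ E) {p : ℕ} (ε : K.Cochain p) : Set K.Polyhedron :=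
  {x | x.1 ∈ K.dualSpace ε}

/-- The closed simplex with vertex set `σ` as a subset of the polyhedron of `K`. -/
def closedSimplex (K : SimplicialComplex ℝ E) (σ : Finset E) : Set K.Polyhedron :=
  {x | x.1 ∈ convexHull ℝ (σ : Set E)}

/-- The inclusion of a closed simplex into the polyhedron. -/
def simplexInclusion (K : SimplicialComplex ℝ E) (σ : K.faces)
    (x : convexHull ℝ (σ.1 : Set E)) : K.Polyhedron :=
  ⟨x.1, K.convexHull_subset_space σ.2 x.2⟩

variable [TopologicalSpace E]

/-- The coherent topology: a subset is closed if and only if its intersection with every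
closed simplex is closed in that simplex. -/
instance (K : SimplicialComplex ℝ E) : TopologicalSpace K.Polyhedron :=
  ⨆ σ : K.faces, TopologicalSpace.coinduced (K.simplexInclusion σ) inferInstance

theorem isClosed_polyhedron_iff (K : SimplicialComplex ℝ E) (A : Set K.Polyhedron) :
    IsClosed A ↔ ∀ σ : K.faces, IsClosed (K.simplexInclusion σ ⁻¹' A) := by
  rw [isClosed_iSup_iff]
  exact forall_congr' fun σ => isClosed_coinduced

theorem continuous_polyhedron_val (K : SimplicialComplex ℝ E) :
    Continuous (fun x : K.Polyhedron => x.1) := by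
  rw [continuous_iSup_dom]
  intro σ
  rw [continuous_coinduced_dom]
  exact continuous_subtype_val

instance [T2Space E] (K : SimplicialComplex ℝ E) : T2Space K.Polyhedron :=
  T2Space.of_injective_continuous Subtype.val_injective K.continuous_polyhedron_val

end Geometry.SimplicialComplex

/-- `A` is isotopic to `B` within `X`: there is a continuous family of homeomorphisms of `X`, from
the identity to a homeomorphism that maps `A` onto `B`. -/
def IsotopicWithin {X : Type u} [TopologicalSpace X] (A B : Set X) : Prop :=
  ∃ h : unitInterval → (X ≃ₜ X), Continuous (fun q : unitInterval × X => h q.1 q.2) ∧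
    h 0 = Homeomorph.refl X ∧ h 1 '' A = B

/-! In barycentric coordinates `w` on a simplex, split the vertices into `T` (label 1) and its
complement. The barycentric subdivision sorts points by the order of their coordinates, and a point
is in `V_ε` exactly when its largest coordinate is attained at vertices of both labels
(`sum_smul_mem_dualSpace_iff`). So `V_ε ∩ σ` is the locus where the sup norms of the `T`-part and
the `Tᶜ`-part of `w` agree. A separating hyperplane `f = 0`, with `F = |f|` on the vertices, is the
locus where the `F`-weighted sums of the two parts agree.

The isotopy multiplies each part by a positive factor, moving linearly from 1 to the ratio of sup
norm to `F`-weighted sum, and then renormalises to total mass 1. At time 1 the weighted sums have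
become the sup norms up to one common factor, so the first locus goes onto the second. The factors
depend only on the directions of the two parts, which the map does not change; hence reciprocal
factors give the inverse.

For the cells take `F = 1`. The same map identifies `V_ε ∩ σ` with the slice where each part has
mass `1/2`, a convex body of dimension `dim σ - 1`, hence a ball. Since no coordinate becomes or
ceases to be zero, the open cell is the trace of `V_ε` on the open simplex and the boundary lies in
proper faces. The CW axioms then follow from those of `|K|`: disjoint open simplices, finitely many
faces, coherent topology. -/

open Set Filter Topology

/-! ### The isotopy of the standard simplex. -/

section Reweight

variable {ι : Type*} [Fintype ι]

/-- The weights `κ i * w i`, normalised to have sum `1`. -/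
noncomputable def reweight (κ w : ι → ℝ) : ι → ℝ := fun i => κ i * w i / ∑ j, κ j * w j

theorem sum_mul_pos_of_mem_stdSimplex {κ w : ι → ℝ} (hκ : ∀ i, 0 < κ i)
    (hw : w ∈ stdSimplex ℝ ι) : 0 < ∑ j, κ j * w j := by
  have hnn : ∀ j, 0 ≤ κ j * w j := fun j => mul_nonneg (hκ j).le (hw.1 j)
  refine lt_of_le_of_ne (Finset.sum_nonneg fun j _ => hnn j) fun h => ?_
  have h0 := (Finset.sum_eq_zero_iff_of_nonneg fun j _ => hnn j).1 h.symm
  have : ∑ j, w j = 0 := Finset.sum_eq_zero fun j hj =>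
    (mul_eq_zero.1 (h0 j hj)).resolve_left (hκ j).ne'
  rw [hw.2] at this
  exact one_ne_zero this

theorem reweight_mem_stdSimplex {κ w : ι → ℝ} (hκ : ∀ i, 0 < κ i) (hw : w ∈ stdSimplex ℝ ι) :
    reweight κ w ∈ stdSimplex ℝ ι := by
  have h := sum_mul_pos_of_mem_stdSimplex hκ hw
  refine ⟨fun i => div_nonneg (mul_nonneg (hκ i).le (hw.1 i)) h.le, ?_⟩
  simp only [reweight]
  rw [← Finset.sum_div, div_self h.ne']

theorem reweight_inv_reweight {κ w : ι → ℝ} (hκ : ∀ i, 0 < κ i) (hw : w ∈ stdSimplex ℝ ι) :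
    reweight (fun i => (κ i)⁻¹) (reweight κ w) = w := by
  have h := sum_mul_pos_of_mem_stdSimplex hκ hw
  have key : ∀ i, (κ i)⁻¹ * reweight κ w i = w i / ∑ j, κ j * w j := fun i => by
    have := (hκ i).ne'
    simp only [reweight]
    field_simp
  funext i
  unfold reweight at key ⊢
  simp only [key]
  rw [← Finset.sum_div, hw.2]
  field_simp

/-- The ratio of the sup norm of a nonnegative vector and a weighted sum of its coordinates. -/
noncomputable def normRatio (F y : ι → ℝ) : ℝ :=
  -- The value at `0` is arbitrary among positive numbers: it only ever multiplies zero coordinates.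
  open Classical in if y = 0 then 1 else ‖y‖ / ∑ i, F i * y i

variable {F : ι → ℝ}

theorem sum_mul_pos_of_ne_zero (hF : ∀ i, 0 < F i) {y : ι → ℝ} (hy : ∀ i, 0 ≤ y i) (h0 : y ≠ 0) :
    0 < ∑ i, F i * y i := by
  obtain ⟨i, hi⟩ := Function.ne_iff.1 h0
  exact Finset.sum_pos' (fun j _ => mul_nonneg (hF j).le (hy j))
    ⟨i, Finset.mem_univ i, mul_pos (hF i) ((hy i).lt_of_ne' hi)⟩

theorem normRatio_pos (hF : ∀ i, 0 < F i) {y : ι → ℝ} (hy : ∀ i, 0 ≤ y i) :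
    0 < normRatio F y := by
  unfold normRatio
  split_ifs with h
  · exact one_pos
  · exact div_pos (norm_pos_iff.2 h) (sum_mul_pos_of_ne_zero hF hy h)

/-- Homogeneity of degree zero is what makes the isotopy invertible: rescaling a part of `w` leaves
its factor unchanged. -/
theorem normRatio_smul {c : ℝ} (hc : 0 < c) (y : ι → ℝ) :
    normRatio F (c • y) = normRatio F y := by
  unfold normRatio
  simp only [smul_eq_zero, hc.ne', false_or]
  split_ifs with h
  · rfl
  · have : ∑ i, F i * (c • y) i = c * ∑ i, F i * y i := by
      rw [Finset.mul_sum]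
      exact Finset.sum_congr rfl fun i _ => by simp only [Pi.smul_apply, smul_eq_mul]; ring
    rw [this, norm_smul, Real.norm_of_nonneg hc.le, mul_div_mul_left _ _ hc.ne']

theorem normRatio_mul_sum (hF : ∀ i, 0 < F i) {y : ι → ℝ} (hy : ∀ i, 0 ≤ y i) :
    normRatio F y * ∑ i, F i * y i = ‖y‖ := by
  unfold normRatio
  split_ifs with h
  · simp [h]
  · exact div_mul_cancel₀ _ (sum_mul_pos_of_ne_zero hF hy h).ne'

/-- The ratio need not extend continuously to `0`; boundedness replaces continuity there. Each `y i`
is `(F i)⁻¹` times one term of the weighted sum, and the extra `1` in the constant covers `y = 0`.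
-/
theorem exists_normRatio_le (hF : ∀ i, 0 < F i) :
    ∃ C, ∀ y : ι → ℝ, (∀ i, 0 ≤ y i) → normRatio F y ≤ C := by
  refine ⟨1 + ∑ i, (F i)⁻¹, fun y hy => ?_⟩
  have hnn : 0 ≤ ∑ i, (F i)⁻¹ := Finset.sum_nonneg fun i _ => (inv_pos.2 (hF i)).le
  unfold normRatio
  split_ifs with h
  · linarith
  · have hs := sum_mul_pos_of_ne_zero hF hy h
    rw [div_le_iff₀ hs]
    refine (pi_norm_le_iff_of_nonneg (by positivity)).2 fun i => ?_
    have h1 : F i * y i ≤ ∑ j, F j * y j := Finset.single_le_sum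
      (f := fun j => F j * y j) (fun j _ => mul_nonneg (hF j).le (hy j)) (Finset.mem_univ i)
    have h2 : (F i)⁻¹ ≤ ∑ j, (F j)⁻¹ := Finset.single_le_sum
      (f := fun j => (F j)⁻¹) (fun j _ => (inv_pos.2 (hF j)).le) (Finset.mem_univ i)
    have h3 : y i = (F i)⁻¹ * (F i * y i) := by
      have := (hF i).ne'
      field_simp
    rw [Real.norm_of_nonneg (hy i), h3]
    calc (F i)⁻¹ * (F i * y i) ≤ (∑ j, (F j)⁻¹) * ∑ j, F j * y j :=
          mul_le_mul h2 h1 (mul_nonneg (hF i).le (hy i)) hnn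
      _ ≤ _ := by
          rw [add_mul, one_mul]
          linarith

theorem continuousAt_normRatio (hF : ∀ i, 0 < F i) {y : ι → ℝ} (hy : ∀ i, 0 ≤ y i)
    (h0 : y ≠ 0) : ContinuousAt (normRatio F) y := by
  have h : ContinuousAt (fun z : ι → ℝ => ‖z‖ / ∑ i, F i * z i) y :=
    ContinuousAt.div continuous_norm.continuousAt
      (continuous_finsetSum _ fun i _ => continuous_const.mul (continuous_apply i)).continuousAt (sum_mul_pos_of_ne_zero hF hy h0).ne'
  refine h.congr ?_
  filter_upwards [isOpen_ne.mem_nhds h0] with z hz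
  simp only [normRatio, if_neg hz]

/-- The weight at `i` in the isotopy at time `t`; it only depends on the coordinates of `w` with
index in the same class of the partition `{T, Tᶜ}` as `i`. -/
noncomputable def isotopyWeight (T : Set ι) (F : ι → ℝ) (t : ℝ) (w : ι → ℝ) (i : ι) : ℝ :=
  1 - t + t * normRatio F ({j | j ∈ T ↔ i ∈ T}.indicator w)

theorem isotopyWeight_zero (T : Set ι) (w : ι → ℝ) (i : ι) : isotopyWeight T F 0 w i = 1 := by
  simp [isotopyWeight]

theorem isotopyWeight_pos (hF : ∀ i, 0 < F i) (T : Set ι) {t : ℝ} (ht : t ∈ Icc (0 : ℝ) 1)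
    {w : ι → ℝ} (hw : ∀ i, 0 ≤ w i) (i : ι) : 0 < isotopyWeight T F t w i := by
  have h := normRatio_pos hF (y := {j | j ∈ T ↔ i ∈ T}.indicator w)
    (fun j => indicator_nonneg (fun k _ => hw k) j)
  unfold isotopyWeight
  rcases ht.1.eq_or_lt with h0 | h0
  · simp [← h0]
  · have := mul_pos h0 h
    linarith [ht.2]

theorem isotopyWeight_congr (T : Set ι) (t : ℝ) (w : ι → ℝ) {i j : ι} (h : j ∈ T ↔ i ∈ T) :
    isotopyWeight T F t w j = isotopyWeight T F t w i := by
  simp only [isotopyWeight, h]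

/-- Factors that are constant on each class only rescale the two parts of `w`, to which the ratios
are blind. -/
theorem isotopyWeight_reweight {T : Set ι} {κ w : ι → ℝ} (hκ : ∀ i, 0 < κ i)
    (hT : ∀ i j, (j ∈ T ↔ i ∈ T) → κ j = κ i) (hw : w ∈ stdSimplex ℝ ι) (t : ℝ) :
    isotopyWeight T F t (reweight κ w) = isotopyWeight T F t w := by
  funext i
  have : {j | j ∈ T ↔ i ∈ T}.indicator (reweight κ w) =
      (κ i / ∑ j, κ j * w j) • {j | j ∈ T ↔ i ∈ T}.indicator w := by
    funext j
    by_cases hj : j ∈ {j | j ∈ T ↔ i ∈ T}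
    · simp only [indicator_of_mem hj, Pi.smul_apply, smul_eq_mul, reweight, hT i j hj]
      ring
    · simp [indicator_of_notMem hj]
  unfold isotopyWeight
  rw [this, normRatio_smul (div_pos (hκ i) (sum_mul_pos_of_mem_stdSimplex hκ hw))]

/-- Where the class of `i` carries mass the factor itself is continuous. Where it carries none, the
factor may jump but stays bounded while `w i` tends to `0`, so the product is squeezed to `0`. -/
theorem continuous_isotopyWeight_mul (hF : ∀ i, 0 < F i) (T : Set ι) (i : ι) :
    Continuous fun q : unitInterval × stdSimplex ℝ ι =>
      isotopyWeight T F q.1 q.2.1 i * q.2.1 i := by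
  set y : unitInterval × stdSimplex ℝ ι → ι → ℝ :=
    fun q => {j | j ∈ T ↔ i ∈ T}.indicator q.2.1 with hy
  have hy0 : ∀ q j, 0 ≤ y q j := fun q j => indicator_nonneg (fun k _ => q.2.2.1 k) j
  have hyc : Continuous y := by
    refine continuous_pi fun j => ?_
    by_cases hj : j ∈ {j | j ∈ T ↔ i ∈ T}
    · simp only [hy, indicator_of_mem hj]
      exact (continuous_apply j).comp (continuous_subtype_val.comp continuous_snd)
    · simp only [hy, indicator_of_notMem hj]
      exact continuous_const
  have hyi : ∀ q, q.2.1 i = y q i := fun q => by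
    simp [hy]
  have hwc : Continuous fun q : unitInterval × stdSimplex ℝ ι => q.2.1 i :=
    (continuous_apply i).comp (continuous_subtype_val.comp continuous_snd)
  obtain ⟨C, hC⟩ := exists_normRatio_le hF
  refine continuous_iff_continuousAt.2 fun q => ?_
  by_cases h0 : y q = 0
  · have hq : q.2.1 i = 0 := by rw [hyi, h0, Pi.zero_apply]
    have hlim : Tendsto (fun q : unitInterval × stdSimplex ℝ ι => (1 + C) * q.2.1 i) (𝓝 q)
        (𝓝 0) := by
      have := (hwc.const_mul (1 + C)).tendsto q
      simpa only [hq, mul_zero] using this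
    unfold ContinuousAt
    simp only [hq, mul_zero]
    refine squeeze_zero (fun r => mul_nonneg
      (isotopyWeight_pos hF T r.1.2 r.2.2.1 i).le (r.2.2.1 i)) (fun r => ?_) hlim
    refine mul_le_mul_of_nonneg_right ?_ (r.2.2.1 i)
    have h1 := hC (y r) (hy0 r)
    have h2 := normRatio_pos hF (hy0 r)
    have h3 := r.1.2.1
    have h4 := r.1.2.2
    change 1 - (r.1 : ℝ) + r.1 * normRatio F (y r) ≤ 1 + C
    nlinarith
  · have h1 : ContinuousAt (fun r => normRatio F (y r)) q :=
      ContinuousAt.comp (f := y) (continuousAt_normRatio hF (hy0 q) h0) hyc.continuousAt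
    have h2 : ContinuousAt (fun r : unitInterval × stdSimplex ℝ ι => (r.1 : ℝ)) q :=
      (continuous_subtype_val.comp continuous_fst).continuousAt
    exact ((continuousAt_const.sub h2).add (h2.mul h1)).mul hwc.continuousAt

/-- The time `t` map of the isotopy, as a bijection of the standard simplex. -/
noncomputable def isotopyEquiv (hF : ∀ i, 0 < F i) (T : Set ι) (t : unitInterval) :
    stdSimplex ℝ ι ≃ stdSimplex ℝ ι where
  toFun w := ⟨reweight (isotopyWeight T F t w.1) w.1,
    reweight_mem_stdSimplex (isotopyWeight_pos hF T t.2 w.2.1) w.2⟩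
  invFun w := ⟨reweight (fun i => (isotopyWeight T F t w.1 i)⁻¹) w.1,
    reweight_mem_stdSimplex (fun i => inv_pos.2 (isotopyWeight_pos hF T t.2 w.2.1 i)) w.2⟩
  left_inv w := by
    have hp := isotopyWeight_pos hF T t.2 w.2.1
    apply Subtype.ext
    simp only
    rw [isotopyWeight_reweight hp (fun i j h => isotopyWeight_congr T t _ h) w.2]
    exact reweight_inv_reweight hp w.2
  right_inv w := by
    have hp := fun i => inv_pos.2 (isotopyWeight_pos hF T t.2 w.2.1 i)
    apply Subtype.ext
    simp only
    rw [isotopyWeight_reweight hp (fun i j h => by rw [isotopyWeight_congr T t _ h]) w.2]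
    have := reweight_inv_reweight hp w.2
    simpa only [inv_inv] using this

theorem continuous_isotopyEquiv (hF : ∀ i, 0 < F i) (T : Set ι) :
    Continuous fun q : unitInterval × stdSimplex ℝ ι => isotopyEquiv hF T q.1 q.2 := by
  refine Continuous.subtype_mk (continuous_pi fun i => ?_) _
  exact (continuous_isotopyWeight_mul hF T i).div
    (continuous_finsetSum _ fun j _ => continuous_isotopyWeight_mul hF T j)
    fun q => (sum_mul_pos_of_mem_stdSimplex (isotopyWeight_pos hF T q.1.2 q.2.2.1) q.2.2).ne'

/-- The time `t` map of the isotopy, as a homeomorphism of the standard simplex. -/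
noncomputable def isotopyHomeo (hF : ∀ i, 0 < F i) (T : Set ι) (t : unitInterval) :
    stdSimplex ℝ ι ≃ₜ stdSimplex ℝ ι :=
  haveI : CompactSpace (stdSimplex ℝ ι) := isCompact_iff_compactSpace.1 (isCompact_stdSimplex ℝ ι)
  Continuous.homeoOfEquivCompactToT2 (f := isotopyEquiv hF T t)
    ((continuous_isotopyEquiv hF T).comp (continuous_const.prodMk continuous_id))

theorem isotopyHomeo_apply (hF : ∀ i, 0 < F i) (T : Set ι) (t : unitInterval)
    (w : stdSimplex ℝ ι) :
    (isotopyHomeo hF T t w).1 = reweight (isotopyWeight T F t w.1) w.1 := rfl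

theorem isotopyHomeo_zero (hF : ∀ i, 0 < F i) (T : Set ι) :
    isotopyHomeo hF T 0 = Homeomorph.refl _ := by
  refine Homeomorph.ext fun w => Subtype.ext (funext fun i => ?_)
  rw [isotopyHomeo_apply]
  have : ∑ i, w.1 i = 1 := w.2.2
  have h1 : isotopyWeight T F ((0 : unitInterval) : ℝ) w.1 = fun _ => 1 := by
    funext j
    exact isotopyWeight_zero T _ j
  rw [h1]
  simp only [reweight, one_mul, this, div_one]
  rfl

theorem isotopyHomeo_apply_eq_zero_iff (hF : ∀ i, 0 < F i) (T : Set ι) (t : unitInterval)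
    (w : stdSimplex ℝ ι) (i : ι) : (isotopyHomeo hF T t w).1 i = 0 ↔ w.1 i = 0 := by
  have hp := isotopyWeight_pos hF T t.2 w.2.1
  rw [isotopyHomeo_apply]
  simp only [reweight, div_eq_zero_iff, mul_eq_zero, (hp i).ne', false_or,
    (sum_mul_pos_of_mem_stdSimplex hp w.2).ne', or_false]

/-- At time 1 each factor times the weighted sum of its part is the sup norm of that part; the
denominator is the common normalisation. -/
theorem sum_indicator_mul_isotopyHomeo_one (hF : ∀ i, 0 < F i) (T : Set ι) (w : stdSimplex ℝ ι) :
    ∑ i, (T.indicator F i - Tᶜ.indicator F i) * (isotopyHomeo hF T 1 w).1 i =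
      (‖T.indicator w.1‖ - ‖Tᶜ.indicator w.1‖) / ∑ j, isotopyWeight T F 1 w.1 j * w.1 j := by
  classical
  have hw : ∀ S : Set ι, ∀ i, 0 ≤ S.indicator w.1 i :=
    fun S => indicator_nonneg fun k _ => w.2.1 k
  rw [isotopyHomeo_apply, ← normRatio_mul_sum hF (hw T), ← normRatio_mul_sum hF (hw Tᶜ),
    Finset.mul_sum, Finset.mul_sum, ← Finset.sum_sub_distrib, Finset.sum_div]
  refine Finset.sum_congr rfl fun i _ => ?_
  by_cases hi : i ∈ T
  · have h1 : {j | j ∈ T ↔ i ∈ T} = T := by ext j; simp [hi]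
    have h2 : i ∉ Tᶜ := fun h => h hi
    simp only [reweight, indicator_of_mem hi, indicator_of_notMem h2]
    simp only [isotopyWeight, h1, Icc.coe_one]
    ring
  · have h1 : {j | j ∈ T ↔ i ∈ T} = Tᶜ := by ext j; simp [hi]
    have h2 : i ∈ Tᶜ := hi
    simp only [reweight, indicator_of_mem h2, indicator_of_notMem hi]
    simp only [isotopyWeight, h1, Icc.coe_one]
    ring

theorem sum_mul_isotopyHomeo_one_eq_zero_iff (hF : ∀ i, 0 < F i) (T : Set ι)
    (w : stdSimplex ℝ ι) :
    ∑ i, (T.indicator F i - Tᶜ.indicator F i) * (isotopyHomeo hF T 1 w).1 i = 0 ↔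
      ‖T.indicator w.1‖ = ‖Tᶜ.indicator w.1‖ := by
  have hp := isotopyWeight_pos hF T (t := 1) ⟨zero_le_one, le_rfl⟩ w.2.1
  rw [sum_indicator_mul_isotopyHomeo_one, div_eq_zero_iff, sub_eq_zero,
    or_iff_left (sum_mul_pos_of_mem_stdSimplex hp w.2).ne']

/-- The two norms are the maxima of `w` over `T` and `Tᶜ`. If equal they cannot both be `0`, as `w`
has sum `1`, so both are attained and are the overall maximum. -/
theorem norm_indicator_eq_iff_exists_isMax (T : Set ι) {w : ι → ℝ} (hw : w ∈ stdSimplex ℝ ι) :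
    ‖T.indicator w‖ = ‖Tᶜ.indicator w‖ ↔
      ∃ a ∈ T, ∃ b ∉ T, w a = w b ∧ ∀ i, w i ≤ w a := by
  have hnn : ∀ S : Set ι, ∀ i, 0 ≤ S.indicator w i :=
    fun S => indicator_nonneg fun k _ => hw.1 k
  have hle : ∀ S : Set ι, ∀ i ∈ S, w i ≤ ‖S.indicator w‖ := fun S i hi => by
    have := norm_le_pi_norm (S.indicator w) i
    rwa [Real.norm_of_nonneg (hnn S i), indicator_of_mem hi] at this
  have hatt : ∀ S : Set ι, S.indicator w ≠ 0 → ∃ a ∈ S, w a = ‖S.indicator w‖ := fun S hS => by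
    obtain ⟨i, hi⟩ := Function.ne_iff.1 hS
    have : Nonempty ι := ⟨i⟩
    obtain ⟨a, ha⟩ := Finite.exists_max (S.indicator w)
    have ha0 : 0 < S.indicator w a := ((hnn S i).lt_of_ne' hi).trans_le (ha i)
    have haS : a ∈ S := by
      by_contra h
      rw [indicator_of_notMem h] at ha0
      exact lt_irrefl _ ha0
    refine ⟨a, haS, le_antisymm (hle S a haS) ?_⟩
    refine (pi_norm_le_iff_of_nonneg (hw.1 a)).2 fun j => ?_
    rw [Real.norm_of_nonneg (hnn S j)]
    exact (ha j).trans_eq (indicator_of_mem haS _)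
  constructor
  · intro h
    have h0 : T.indicator w ≠ 0 := fun h0 => by
      have h1 : Tᶜ.indicator w = 0 := by
        rw [← norm_eq_zero, ← h, h0, norm_zero]
      have h2 : w = 0 := by rw [← indicator_self_add_compl T w, h0, h1, add_zero]
      have := hw.2
      simp [h2] at this
    have h0' : Tᶜ.indicator w ≠ 0 := by
      rwa [← norm_ne_zero_iff, ← h, norm_ne_zero_iff]
    obtain ⟨a, haT, ha⟩ := hatt T h0
    obtain ⟨b, hbT, hb⟩ := hatt Tᶜ h0'
    refine ⟨a, haT, b, hbT, by rw [ha, hb, h], fun i => ?_⟩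
    by_cases hi : i ∈ T
    · exact (hle T i hi).trans_eq ha.symm
    · rw [ha, h]
      exact hle Tᶜ i hi
  · rintro ⟨a, haT, b, hbT, hab, hmax⟩
    have hup : ∀ S : Set ι, ‖S.indicator w‖ ≤ w a := fun S =>
      (pi_norm_le_iff_of_nonneg (hw.1 a)).2 fun j => by
        rw [Real.norm_of_nonneg (hnn S j)]
        exact (indicator_le_self' (fun k _ => hw.1 k) j).trans (hmax j)
    have h1 := hle T a haT
    have h2 := hle Tᶜ b hbT
    rw [← hab] at h2
    exact ((hup T).antisymm h1).trans ((hup Tᶜ).antisymm h2).symm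

end Reweight

/-- An affinely independent family takes prescribed values under some affine map. -/
theorem AffineIndependent.exists_affineMap_apply_eq {ι E : Type*} [AddCommGroup E] [Module ℝ E]
    {p : ι → E} (hp : AffineIndependent ℝ p) (c : ι → ℝ) :
    ∃ f : E →ᵃ[ℝ] ℝ, ∀ i, f (p i) = c i := by
  rcases isEmpty_or_nonempty ι with h | ⟨⟨i₀⟩⟩
  · exact ⟨AffineMap.const ℝ E 0, fun i => h.elim i⟩
  have hl := (affineIndependent_iff_linearIndependent_vsub ℝ p i₀).1 hp
  -- A left inverse of the injective map given by the differences `p i - p i₀` provides coordinates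
  -- on all of `E`, even if the family does not span.
  obtain ⟨g, hg⟩ := LinearMap.exists_leftInverse_of_injective _
    (LinearMap.ker_eq_bot.2 hl)
  set L : E →ₗ[ℝ] ℝ :=
    (Finsupp.linearCombination ℝ fun i : {x // x ≠ i₀} => c i - c i₀) ∘ₗ g with hL
  refine ⟨L.toAffineMap + AffineMap.const ℝ E (c i₀ - L (p i₀)), fun i => ?_⟩
  have key : L (p i - p i₀) = c i - c i₀ := by
    by_cases hi : i = i₀
    · simp [hi]
    · have h1 : g (p i - p i₀) = Finsupp.single ⟨i, hi⟩ 1 := by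
        have := LinearMap.congr_fun hg (Finsupp.single ⟨i, hi⟩ 1)
        simpa using this
      simp [hL, h1]
  rw [map_sub] at key
  simp only [AffineMap.coe_add, LinearMap.coe_toAffineMap, AffineMap.coe_const, Pi.add_apply,
    Function.const_apply]
  linarith

/-! ### The half-mass slice of a simplex is a ball. -/

section HalfSums

variable {ι : Type*} [Fintype ι]

theorem sum_indicator_sub_indicator_compl_mul (T : Set ι) (w : ι → ℝ) :
    ∑ i, (T.indicator 1 i - Tᶜ.indicator 1 i) * w i =
      ∑ i, T.indicator w i - ∑ i, Tᶜ.indicator w i := by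
  rw [← Finset.sum_sub_distrib]
  refine Finset.sum_congr rfl fun i _ => ?_
  by_cases hi : i ∈ T <;> simp [hi]

theorem sum_eq_sum_indicator_add_sum_indicator_compl (T : Set ι) (w : ι → ℝ) :
    ∑ i, w i = ∑ i, T.indicator w i + ∑ i, Tᶜ.indicator w i := by
  rw [← Finset.sum_add_distrib]
  exact Finset.sum_congr rfl fun i _ => (congrFun (indicator_self_add_compl T w) i).symm

/-- The two mass equations are solved for the coordinates at `a` and `b`, one in each class; the
other `p` coordinates are free parameters. -/
theorem exists_affine_parametrization_of_half_sums {p : ℕ}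
    (hcard : Fintype.card ι = p + 2) {T : Set ι} {a b : ι} (ha : a ∈ T) (hb : b ∉ T) :
    ∃ L : (Fin p → ℝ) → ι → ℝ, Continuous L ∧
      (∀ (s t : ℝ) (u v : Fin p → ℝ), s + t = 1 → L (s • u + t • v) = s • L u + t • L v) ∧
      (∀ j, ∃ i, ∀ u, L u i = u j) ∧ (∀ u, ∑ i, T.indicator (L u) i = 1 / 2) ∧
      (∀ u, ∑ i, Tᶜ.indicator (L u) i = 1 / 2) ∧
      ∀ w : ι → ℝ, ∑ i, T.indicator w i = 1 / 2 → ∑ i, Tᶜ.indicator w i = 1 / 2 →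
        ∃ u, L u = w := by
  classical
  have hab : a ≠ b := fun h => hb (h ▸ ha)
  have hsub : Fintype.card {i // i ≠ a ∧ i ≠ b} = p := by
    rw [Fintype.card_subtype]
    have : (Finset.univ.filter fun i => i ≠ a ∧ i ≠ b) = (Finset.univ.erase a).erase b := by
      ext i
      simp [and_comm]
    rw [this, Finset.card_erase_of_mem (by simp [hab.symm]),
      Finset.card_erase_of_mem (Finset.mem_univ a), Finset.card_univ, hcard]
    rfl
  obtain ⟨e⟩ : Nonempty ({i // i ≠ a ∧ i ≠ b} ≃ Fin p) := ⟨Fintype.equivFinOfCardEq hsub⟩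
  let ext0 : (Fin p → ℝ) → ι → ℝ := fun u i => if h : i ≠ a ∧ i ≠ b then u (e ⟨i, h⟩) else 0
  let L : (Fin p → ℝ) → ι → ℝ := fun u i =>
    if i = a then 1 / 2 - ∑ j, T.indicator (ext0 u) j
    else if i = b then 1 / 2 - ∑ j, Tᶜ.indicator (ext0 u) j else ext0 u i
  have hext_add : ∀ (s t : ℝ) (u v : Fin p → ℝ) (i : ι),
      ext0 (s • u + t • v) i = s * ext0 u i + t * ext0 v i := fun s t u v i => by
    by_cases h : i ≠ a ∧ i ≠ b <;> simp [ext0, h]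
  have hind_add : ∀ (S : Set ι) (s t : ℝ) (u v : Fin p → ℝ),
      ∑ i, S.indicator (ext0 (s • u + t • v)) i =
        s * ∑ i, S.indicator (ext0 u) i + t * ∑ i, S.indicator (ext0 v) i :=
    fun S s t u v => by
      rw [Finset.mul_sum, Finset.mul_sum, ← Finset.sum_add_distrib]
      refine Finset.sum_congr rfl fun i _ => ?_
      by_cases hi : i ∈ S
      · simp only [indicator_of_mem hi, hext_add]
      · simp only [indicator_of_notMem hi, mul_zero, add_zero]
  have hLconv : ∀ (s t : ℝ) (u v : Fin p → ℝ), s + t = 1 → ∀ i,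
      L (s • u + t • v) i = s * L u i + t * L v i := fun s t u v hst i => by
    have h2 : t = 1 - s := by linarith
    simp only [L, hind_add, hext_add]
    split_ifs
    · rw [h2]; ring
    · rw [h2]; ring
    · rfl
  have hextc : Continuous ext0 := continuous_pi fun i => by
    by_cases h : i ≠ a ∧ i ≠ b
    · simp only [ext0, h, dite_true, ne_eq, not_false_eq_true, and_self]
      exact continuous_apply _
    · simp only [ext0, h, dite_false]
      exact continuous_const
  have hindc : ∀ S : Set ι, Continuous fun u => ∑ j, S.indicator (ext0 u) j := fun S =>
    continuous_finsetSum _ fun j _ => by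
      by_cases hj : j ∈ S
      · simp only [indicator_of_mem hj]
        exact (continuous_apply j).comp hextc
      · simp only [indicator_of_notMem hj]
        exact continuous_const
  have hLc : Continuous L := continuous_pi fun i => by
    by_cases h1 : i = a
    · simp only [L, h1, if_true]
      exact continuous_const.sub (hindc T)
    · by_cases h2 : i = b
      · simp only [L, h2, if_true, if_neg hab.symm]
        exact continuous_const.sub (hindc Tᶜ)
      · simp only [L, h1, h2, if_false]
        exact (continuous_apply i).comp hextc
  have hLe : ∀ u j, L u (e.symm j) = u j := fun u j => by
    have h := (e.symm j).2
    simp [L, ext0, h.1, h.2]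
  have hLT : ∀ u, ∑ i, T.indicator (L u) i = 1 / 2 := fun u => by
    have : ∀ i, T.indicator (L u) i = T.indicator (ext0 u) i +
        if i = a then 1 / 2 - ∑ j, T.indicator (ext0 u) j else 0 := fun i => by
      by_cases hi : i ∈ T
      · have hib : i ≠ b := fun h => hb (h ▸ hi)
        by_cases hia : i = a
        · subst hia
          simp [L, ext0, hi]
        · simp [L, hi, hia, hib]
      · have hia : i ≠ a := fun h => hi (h ▸ ha)
        simp [hi, hia]
    simp only [this, Finset.sum_add_distrib, Finset.sum_ite_eq', Finset.mem_univ, if_true]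
    ring
  have hLTc : ∀ u, ∑ i, Tᶜ.indicator (L u) i = 1 / 2 := fun u => by
    have : ∀ i, Tᶜ.indicator (L u) i = Tᶜ.indicator (ext0 u) i +
        if i = b then 1 / 2 - ∑ j, Tᶜ.indicator (ext0 u) j else 0 := fun i => by
      by_cases hi : i ∈ Tᶜ
      · have hia : i ≠ a := fun h => hi (h ▸ ha)
        by_cases hib : i = b
        · subst hib
          simp [L, ext0, hi, hia]
        · simp only [indicator_of_mem hi]
          simp [L, hia, hib]
      · have hib : i ≠ b := fun h => hi (h ▸ hb)
        simp only [indicator_of_notMem hi]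
        simp [hib]
    simp only [this, Finset.sum_add_distrib, Finset.sum_ite_eq', Finset.mem_univ, if_true]
    ring
  have hLsurj : ∀ w : ι → ℝ, ∑ i, T.indicator w i = 1 / 2 → ∑ i, Tᶜ.indicator w i = 1 / 2 →
      L (fun j => w (e.symm j)) = w := fun w h1 h2 => by
    set u : Fin p → ℝ := fun j => w (e.symm j) with hu
    have h0 : ∀ i, i ≠ a → i ≠ b → L u i = w i := fun i hia hib => by
      simp [L, ext0, hia, hib, hu]
    have hA : L u a = w a := by
      have h3 := (hLT u).trans h1.symm
      rw [← Finset.add_sum_erase _ _ (Finset.mem_univ a),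
        ← Finset.add_sum_erase _ (T.indicator w) (Finset.mem_univ a),
        indicator_of_mem ha, indicator_of_mem ha] at h3
      have h4 : ∑ i ∈ Finset.univ.erase a, T.indicator (L u) i =
          ∑ i ∈ Finset.univ.erase a, T.indicator w i := Finset.sum_congr rfl fun i hi => by
        by_cases hiT : i ∈ T
        · rw [indicator_of_mem hiT, indicator_of_mem hiT,
            h0 i (Finset.ne_of_mem_erase hi) fun h => hb (h ▸ hiT)]
        · rw [indicator_of_notMem hiT, indicator_of_notMem hiT]
      linarith
    have hB : L u b = w b := by
      have h3 := (hLTc u).trans h2.symm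
      have hb' : b ∈ Tᶜ := hb
      rw [← Finset.add_sum_erase _ _ (Finset.mem_univ b),
        ← Finset.add_sum_erase _ (Tᶜ.indicator w) (Finset.mem_univ b),
        indicator_of_mem hb', indicator_of_mem hb'] at h3
      have h4 : ∑ i ∈ Finset.univ.erase b, Tᶜ.indicator (L u) i =
          ∑ i ∈ Finset.univ.erase b, Tᶜ.indicator w i := Finset.sum_congr rfl fun i hi => by
        by_cases hiT : i ∈ Tᶜ
        · rw [indicator_of_mem hiT, indicator_of_mem hiT,
            h0 i (fun h => hiT (h ▸ ha)) (Finset.ne_of_mem_erase hi)]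
        · rw [indicator_of_notMem hiT, indicator_of_notMem hiT]
      linarith
    funext i
    by_cases hia : i = a
    · rw [hia, hA]
    by_cases hib : i = b
    · rw [hib, hB]
    exact h0 i hia hib
  exact ⟨L, hLc, fun s t u v h => funext fun i => by simpa using hLconv s t u v h i,
    fun j => ⟨e.symm j, fun u => hLe u j⟩, hLT, hLTc, 
    fun w h1 h2 => ⟨fun j => w (e.symm j), hLsurj w h1 h2⟩⟩

/-- In the free parameters, positivity of all coordinates cuts out a nonempty bounded open convex
set whose closure is the nonnegative locus. A homeomorphism of the ambient space carries such a set
and its closure to the open and closed unit balls. -/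
theorem exists_closedBall_parametrization {p : ℕ}
    (hcard : Fintype.card ι = p + 2) {T : Set ι} {a b : ι} (ha : a ∈ T) (hb : b ∉ T) :
    ∃ g : (Fin p → ℝ) → ι → ℝ, Continuous g ∧ Function.Injective g ∧
      g '' Metric.closedBall 0 1 = {w | w ∈ stdSimplex ℝ ι ∧
        ∑ i, (T.indicator 1 i - Tᶜ.indicator 1 i) * w i = 0} ∧
      g '' Metric.ball 0 1 = {w | w ∈ stdSimplex ℝ ι ∧
        ∑ i, (T.indicator 1 i - Tᶜ.indicator 1 i) * w i = 0 ∧ ∀ i, 0 < w i} := by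
  classical
  obtain ⟨L, hLc, hLconv', hLe, hLT, hLTc, hLsurj⟩ :=
    exists_affine_parametrization_of_half_sums hcard ha hb
  have hLconv : ∀ (s t : ℝ) (u v : Fin p → ℝ), s + t = 1 → ∀ i,
      L (s • u + t • v) i = s * L u i + t * L v i := fun s t u v h i => by
    simp [hLconv' s t u v h]
  have hLinj : Function.Injective L := fun u v h => funext fun j => by
    obtain ⟨i, hi⟩ := hLe j
    rw [← hi u, ← hi v, h]
  have hsplit := sum_indicator_sub_indicator_compl_mul T
  have hsplit' := sum_eq_sum_indicator_add_sum_indicator_compl T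
  have hmem : ∀ u, (∀ i, 0 ≤ L u i) → L u ∈ stdSimplex ℝ ι ∧
      ∑ i, (T.indicator 1 i - Tᶜ.indicator 1 i) * L u i = 0 := fun u hu =>
    ⟨⟨hu, by rw [hsplit', hLT, hLTc]; norm_num⟩, by rw [hsplit, hLT, hLTc, sub_self]⟩
  have hpre : ∀ w ∈ stdSimplex ℝ ι, ∑ i, (T.indicator 1 i - Tᶜ.indicator 1 i) * w i = 0 →
      ∃ u, L u = w := fun w hw h => by
    have h1 := hw.2
    rw [hsplit'] at h1
    rw [hsplit] at h
    exact hLsurj w (by linarith) (by linarith)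
  set S : Set (Fin p → ℝ) := {u | ∀ i, 0 < L u i} with hS
  have hSopen : IsOpen S := by
    have : S = ⋂ i, {u | 0 < L u i} := by ext u; simp [hS]
    rw [this]
    exact isOpen_iInter_of_finite fun i =>
      isOpen_lt continuous_const ((continuous_apply i).comp hLc)
  have hSconv : Convex ℝ S := by
    intro u hu v hv s t hs ht hst i
    rw [hLconv s t u v hst]
    rcases hs.eq_or_lt with rfl | hs'
    · have : t = 1 := by linarith
      simpa [this] using hv i
    · exact add_pos_of_pos_of_nonneg (mul_pos hs' (hu i)) (mul_nonneg ht (hv i).le)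
  obtain ⟨u₀, hu₀⟩ : S.Nonempty := by
    have hT0 : (0 : ℝ) < ∑ i, T.indicator 1 i :=
      Finset.sum_pos' (fun i _ => indicator_nonneg (fun _ _ => zero_le_one) i)
        ⟨a, Finset.mem_univ a, by simp [ha]⟩
    have hTc0 : (0 : ℝ) < ∑ i, Tᶜ.indicator 1 i :=
      Finset.sum_pos' (fun i _ => indicator_nonneg (fun _ _ => zero_le_one) i)
        ⟨b, Finset.mem_univ b, by simp [hb]⟩
    set m : ℝ := ∑ i, T.indicator 1 i
    set n : ℝ := ∑ i, Tᶜ.indicator 1 i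
    -- An interior point: mass `1/2` spread evenly over each class, with `m` and `n` the sizes of
    -- the classes.
    let w : ι → ℝ := fun i => if i ∈ T then 1 / (2 * m) else 1 / (2 * n)
    have h1 : ∑ i, T.indicator w i = 1 / 2 := by
      have : ∀ i, T.indicator w i = 1 / (2 * m) * T.indicator 1 i := fun i => by
        by_cases hi : i ∈ T <;> simp [w, hi]
      simp only [this, ← Finset.mul_sum]
      change 1 / (2 * m) * m = 1 / 2
      field_simp
    have h2 : ∑ i, Tᶜ.indicator w i = 1 / 2 := by
      have : ∀ i, Tᶜ.indicator w i = 1 / (2 * n) * Tᶜ.indicator 1 i := fun i => by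
        by_cases hi : i ∈ T <;> simp [w, hi]
      simp only [this, ← Finset.mul_sum]
      change 1 / (2 * n) * n = 1 / 2
      field_simp
    obtain ⟨u, hu⟩ := hLsurj w h1 h2
    refine ⟨u, fun i => ?_⟩
    rw [hu]
    simp only [w]
    split_ifs <;> positivity
  have hSclos : closure S = {u | ∀ i, 0 ≤ L u i} := by
    apply Subset.antisymm
    · refine closure_minimal (fun u hu i => (hu i).le) ?_
      have : {u | ∀ i, 0 ≤ L u i} = ⋂ i, {u | 0 ≤ L u i} := by ext u; simp
      rw [this]
      exact isClosed_iInter fun i => isClosed_le continuous_const ((continuous_apply i).comp hLc)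
    · intro u hu
      -- A boundary point is approached along the segment towards the interior point `u₀`.
      have hlim : Tendsto (fun t : ℝ => (1 - t) • u + t • u₀) (𝓝[>] 0) (𝓝 u) := by
        have hc : Continuous fun t : ℝ => (1 - t) • u + t • u₀ := by fun_prop
        have := hc.tendsto 0
        simp only [sub_zero, one_smul, zero_smul, add_zero] at this
        exact this.mono_left nhdsWithin_le_nhds
      refine mem_closure_of_tendsto hlim ?_
      filter_upwards [Ioo_mem_nhdsGT (zero_lt_one (α := ℝ))] with t ht i
      rw [hLconv _ _ _ _ (by ring)]
      exact add_pos_of_nonneg_of_pos (mul_nonneg (by linarith [ht.2]) (hu i))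
        (mul_pos ht.1 (hu₀ i))
  have hSbdd : Bornology.IsBounded S := by
    refine (Metric.isBounded_closedBall (x := (0 : Fin p → ℝ)) (r := 1)).subset fun u hu => ?_
    have hstd := (hmem u fun i => (hu i).le).1
    rw [mem_closedBall_zero_iff]
    refine (pi_norm_le_iff_of_nonneg zero_le_one).2 fun j => ?_
    obtain ⟨i, hi⟩ := hLe j
    have := mem_Icc_of_mem_stdSimplex hstd i
    rw [hi] at this
    rw [Real.norm_of_nonneg this.1]
    exact this.2
  obtain ⟨h, hint, hclos, -⟩ := exists_homeomorph_image_interior_closure_frontier_eq_unitBall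
    hSconv (by rw [hSopen.interior_eq]; exact ⟨u₀, hu₀⟩) hSbdd
  rw [hSopen.interior_eq] at hint
  refine ⟨L ∘ h.symm, hLc.comp h.symm.continuous, hLinj.comp h.symm.injective, ?_, ?_⟩
  · rw [← hclos, image_comp, ← image_comp h.symm h, h.symm_comp_self, image_id, hSclos]
    ext w
    constructor
    · rintro ⟨u, hu, rfl⟩
      exact hmem u hu
    · rintro ⟨hw, h0⟩
      obtain ⟨u, rfl⟩ := hpre w hw h0
      exact ⟨u, hw.1, rfl⟩
  · rw [← hint, image_comp, ← image_comp h.symm h, h.symm_comp_self, image_id]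
    ext w
    constructor
    · rintro ⟨u, hu, rfl⟩
      have := hmem u fun i => (hu i).le
      exact ⟨this.1, this.2, hu⟩
    · rintro ⟨hw, h0, hpos⟩
      obtain ⟨u, rfl⟩ := hpre w hw h0
      exact ⟨u, hpos, rfl⟩

end HalfSums

/-! ### Superlevel chains, barycentric coordinates and labels. -/

open Classical in
/-- A nonnegative function with finite support is a nonnegative combination of the indicators of
a chain of subsets of its support, all of which contain every point where it is maximal. -/
theorem Finset.exists_chain_decomposition {α : Type*} (σ : Finset α) :
    ∀ w : α → ℝ, (∀ v ∈ σ, 0 < w v) → (∀ v ∉ σ, w v = 0) →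
      ∃ (c : Finset (Finset α)) (l : Finset α → ℝ), IsChain (· ⊆ ·) (c : Set (Finset α)) ∧
        (∀ τ ∈ c, τ ⊆ σ ∧ ∀ a, (∀ v, w v ≤ w a) → a ∈ τ) ∧ (∀ τ ∈ c, 0 ≤ l τ) ∧
        ∀ v, w v = ∑ τ ∈ c, if v ∈ τ then l τ else 0 := by
  induction σ using Finset.strongInduction with
  | H σ ih =>
  intro w hpos hzero
  rcases σ.eq_empty_or_nonempty with rfl | hne
  · exact ⟨∅, 0, by simp, by simp, by simp, fun v => by simpa using hzero v⟩
  obtain ⟨v₀, hv₀, hmin⟩ := σ.exists_min_image w hne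
  set σ' := σ.filter fun v => w v₀ < w v with hσ'
  have hss : σ' ⊂ σ := Finset.filter_ssubset.2 ⟨v₀, hv₀, lt_irrefl _⟩
  -- Peel off the minimum value on the support: the remainder lives on the strict superlevel set,
  -- and `σ` joins the chain with coefficient `w v₀`.
  obtain ⟨c, l, hc, hcσ, hl, hw⟩ := ih σ' hss (fun v => if v ∈ σ then w v - w v₀ else 0)
    (fun v hv => by
      have := Finset.mem_filter.1 hv
      simp only [this.1, if_true]
      linarith [this.2])
    (fun v hv => by
      by_cases h : v ∈ σ
      · have h1 : ¬ w v₀ < w v := fun h1 => hv (Finset.mem_filter.2 ⟨h, h1⟩)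
        simp only [h, if_true]
        linarith [hmin v h]
      · simp only [h, if_false])
  have hσc : σ ∉ c := fun h => hss.2 (hcσ σ h).1
  refine ⟨insert σ c, Function.update l σ (w v₀), ?_, ?_, ?_, ?_⟩
  · rw [Finset.coe_insert]
    exact hc.insert fun τ hτ _ => Or.inr ((hcσ τ hτ).1.trans hss.1)
  · intro τ hτ
    have hmax : ∀ a, (∀ v, w v ≤ w a) → a ∈ σ := fun a ha => by
      by_contra h
      have h1 := ha v₀
      rw [hzero a h] at h1
      exact absurd (hpos v₀ hv₀) h1.not_gt
    rcases Finset.mem_insert.1 hτ with rfl | hτ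
    · exact ⟨subset_rfl, hmax⟩
    · refine ⟨(hcσ τ hτ).1.trans hss.1, fun a ha => (hcσ τ hτ).2 a fun v => ?_⟩
      have ha' := hmax a ha
      simp only [ha', if_true]
      split_ifs with hv
      · linarith [ha v]
      · linarith [ha v₀]
  · intro τ hτ
    rcases Finset.mem_insert.1 hτ with rfl | hτ
    · rw [Function.update_self]
      exact (hpos _ hv₀).le
    · rw [Function.update_of_ne (ne_of_mem_of_not_mem hτ hσc)]
      exact hl τ hτ
  · intro v
    rw [Finset.sum_insert hσc, Function.update_self]
    have h1 : (∑ τ ∈ c, if v ∈ τ then Function.update l σ (w v₀) τ else 0) =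
        ∑ τ ∈ c, if v ∈ τ then l τ else 0 := Finset.sum_congr rfl fun τ hτ => by
      rw [Function.update_of_ne (ne_of_mem_of_not_mem hτ hσc)]
    rw [h1, ← hw v]
    by_cases hv : v ∈ σ
    · simp [hv]
    · simp [hv, hzero v hv]

namespace Geometry.SimplicialComplex

/-- Barycentric coordinates of a point of the simplex with vertex set `σ`, extended by zero. -/
structure IsWeight {α : Type*} (σ : Finset α) (w : α → ℝ) : Prop where
  nonneg : ∀ v, 0 ≤ w v
  eq_zero : ∀ v ∉ σ, w v = 0
  sum_eq_one : ∑ v ∈ σ, w v = 1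

theorem IsWeight.mono {α : Type*} {σ τ : Finset α} {w : α → ℝ} (hw : IsWeight σ w) (h : σ ⊆ τ) :
    IsWeight τ w :=
  ⟨hw.nonneg, fun v hv => hw.eq_zero v fun hv' => hv (h hv'), by
    rw [← hw.sum_eq_one]
    exact (Finset.sum_subset h fun v _ hv => hw.eq_zero v hv).symm⟩

variable {E : Type u} [AddCommGroup E] [Module ℝ E]

section Labels

open Classical in
/-- The label of a vertex. -/
noncomputable def label (K : SimplicialComplex ℝ E) (ε : K.Cochain 0) (v : E) : ZMod 2 :=
  if h : {v} ∈ K.faces then ε ⟨{v}, h, rfl⟩ else 0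

variable {K : SimplicialComplex ℝ E} {ε : K.Cochain 0} {σ : Finset E}

theorem apply_eq_label (a : K.Simplices 0) {v : E} (hv : v ∈ a.1) : ε a = K.label ε v := by
  obtain ⟨s, hs, hc⟩ := a
  obtain ⟨u, rfl⟩ := Finset.card_eq_one.1 hc
  obtain rfl := Finset.mem_singleton.1 hv
  simp [label, hs]

theorem singleton_mem_faces (hσ : σ ∈ K.faces) {v : E} (hv : v ∈ σ) : {v} ∈ K.faces :=
  K.down_closed hσ (Finset.singleton_subset_iff.2 hv) (Finset.singleton_nonempty v)

theorem apply_singleton_eq_label {v : E} (h : {v} ∈ K.faces ∧ ({v} : Finset E).card = 0 + 1) :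
    ε ⟨{v}, h⟩ = K.label ε v :=
  apply_eq_label _ (Finset.mem_singleton_self v)

theorem isConstOn_iff_label (hσ : σ ∈ K.faces) :
    K.IsConstOn ε σ ↔ ∀ a ∈ σ, ∀ b ∈ σ, K.label ε a = K.label ε b := by
  constructor
  · intro h a ha b hb
    have := h ⟨{a}, singleton_mem_faces hσ ha, rfl⟩ ⟨{b}, singleton_mem_faces hσ hb, rfl⟩
      (Finset.singleton_subset_iff.2 ha) (Finset.singleton_subset_iff.2 hb)
    rwa [apply_singleton_eq_label (ε := ε), apply_singleton_eq_label (ε := ε)] at this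
  · intro h a b ha hb
    obtain ⟨v, hv⟩ := nonempty_of_mem_faces a.2.1
    obtain ⟨w, hw⟩ := nonempty_of_mem_faces b.2.1
    rw [apply_eq_label (ε := ε) a hv, apply_eq_label (ε := ε) b hw]
    exact h v (ha hv) w (hb hw)

theorem separates_iff_label (hσ : σ ∈ K.faces) {f : E →ᵃ[ℝ] ℝ} :
    K.Separates ε σ f ↔
      ∀ v ∈ σ, (K.label ε v = 1 → 0 < f v) ∧ (K.label ε v = 0 → f v < 0) := by
  constructor
  · intro h v hv
    have := h ⟨{v}, singleton_mem_faces hσ hv, rfl⟩ v (Finset.mem_singleton_self v) hv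
    rwa [apply_singleton_eq_label (ε := ε)] at this
  · intro h a v hv hvσ
    rw [apply_eq_label (ε := ε) a hv]
    exact h v hvσ

/-- On an edge the coboundary is the sum of the two end labels, which mod 2 vanishes exactly when
they agree. -/
theorem coboundary_ne_zero_iff (σ : K.Simplices (0 + 1)) :
    K.coboundary ε σ ≠ 0 ↔ ∃ a ∈ σ.1, ∃ b ∈ σ.1, K.label ε a ≠ K.label ε b := by
  classical
  obtain ⟨s, hs, hc⟩ := σ
  obtain ⟨a, b, hab, rfl⟩ := Finset.card_eq_two.1 hc
  have ha : a ∈ ({a, b} : Finset E) := by simp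
  have hb : b ∈ ({a, b} : Finset E) := by simp
  have huniv : (Finset.univ : Finset {v : E // v ∈ ({a, b} : Finset E)}) =
      {⟨a, ha⟩, ⟨b, hb⟩} := by
    ext ⟨v, hv⟩
    have := Finset.mem_insert.1 hv
    rw [Finset.mem_singleton] at this
    simp only [Finset.mem_univ, true_iff, Finset.mem_insert, Finset.mem_singleton,
      Subtype.mk.injEq]
    exact this
  have key : K.coboundary ε ⟨{a, b}, hs, hc⟩ = K.label ε b + K.label ε a := by
    unfold coboundary
    rw [huniv, Finset.sum_pair (by simpa using hab)]
    congr 1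
    · exact apply_eq_label _ (Finset.mem_erase.2 ⟨hab.symm, hb⟩)
    · exact apply_eq_label _ (Finset.mem_erase.2 ⟨hab, ha⟩)
  rw [key]
  have hz : ∀ x y : ZMod 2, y + x ≠ 0 ↔ x ≠ y := by decide
  rw [hz]
  constructor
  · exact fun h => ⟨a, ha, b, hb, h⟩
  · rintro ⟨x, hx, y, hy, hxy⟩
    simp only [Finset.mem_insert, Finset.mem_singleton] at hx hy
    rcases hx with rfl | rfl <;> rcases hy with rfl | rfl
    exacts [absurd rfl hxy, hxy, hxy.symm, absurd rfl hxy]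

end Labels

section Weights

theorem IsWeight.sum_smul_eq_of_subset {σ τ : Finset E} {w : E → ℝ} (hw : IsWeight σ w)
    (h : σ ⊆ τ) : ∑ v ∈ τ, w v • v = ∑ v ∈ σ, w v • v :=
  (Finset.sum_subset h fun v _ hv => by rw [hw.eq_zero v hv, zero_smul]).symm

theorem mem_convexHull_iff_exists_isWeight {σ : Finset E} {x : E} :
    x ∈ convexHull ℝ (σ : Set E) ↔ ∃ w, IsWeight σ w ∧ ∑ v ∈ σ, w v • v = x := by
  classical
  rw [Finset.mem_convexHull]
  constructor
  · rintro ⟨w, hw0, hw1, rfl⟩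
    have hs : ∀ v ∈ σ, (if v ∈ σ then w v else 0) = w v := fun v hv => if_pos hv
    refine ⟨fun v => if v ∈ σ then w v else 0, ⟨fun v => ?_, fun v hv => if_neg hv, ?_⟩, ?_⟩
    · split_ifs with h
      exacts [hw0 v h, le_rfl]
    · rw [← hw1]
      exact Finset.sum_congr rfl hs
    · rw [Finset.centerMass_eq_of_sum_1 _ _ hw1]
      exact Finset.sum_congr rfl fun v hv => by simp only [hs v hv, id]
  · rintro ⟨w, hw, rfl⟩
    exact ⟨w, fun v _ => hw.nonneg v, hw.sum_eq_one,
      Finset.centerMass_eq_of_sum_1 _ _ hw.sum_eq_one⟩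

variable {K : SimplicialComplex ℝ E} {σ τ : Finset E}

theorem IsWeight.eq_of_sum_smul_eq_of_subset (hσ : σ ∈ K.faces) (h : τ ⊆ σ) {w w' : E → ℝ}
    (hw : IsWeight σ w) (hw' : IsWeight τ w')
    (heq : ∑ v ∈ σ, w v • v = ∑ v ∈ τ, w' v • v) : w = w' := by
  have hw'' := hw'.mono h
  rw [← hw'.sum_smul_eq_of_subset h] at heq
  have := (K.indep hσ).eq_of_sum_eq_sum (s := Finset.univ) (w₁ := fun v : σ => w v)
    (w₂ := fun v : σ => w' v)
    (by
      rw [Finset.sum_coe_sort σ w, Finset.sum_coe_sort σ w', hw.sum_eq_one, hw''.sum_eq_one])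
    (by
      rwa [Finset.sum_coe_sort σ fun v => w v • v, Finset.sum_coe_sort σ fun v => w' v • v])
  funext v
  by_cases hv : v ∈ σ
  · exact this ⟨v, hv⟩ (Finset.mem_univ _)
  · rw [hw.eq_zero v hv, hw''.eq_zero v hv]

/-- The common point lies in the hull of `σ ∩ τ`; affine independence in each face identifies both
weights with its weight there. -/
theorem IsWeight.eq_of_sum_smul_eq (hσ : σ ∈ K.faces) (hτ : τ ∈ K.faces) {w w' : E → ℝ}
    (hw : IsWeight σ w) (hw' : IsWeight τ w')
    (heq : ∑ v ∈ σ, w v • v = ∑ v ∈ τ, w' v • v) : w = w' := by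
  classical
  have hx := K.inter_subset_convexHull hσ hτ
    ⟨mem_convexHull_iff_exists_isWeight.2 ⟨w, hw, rfl⟩,
      mem_convexHull_iff_exists_isWeight.2 ⟨w', hw', heq.symm⟩⟩
  rw [← Finset.coe_inter, mem_convexHull_iff_exists_isWeight] at hx
  obtain ⟨w₀, hw₀, h0⟩ := hx
  rw [hw.eq_of_sum_smul_eq_of_subset hσ Finset.inter_subset_left hw₀ h0.symm,
    hw'.eq_of_sum_smul_eq_of_subset hτ Finset.inter_subset_right hw₀ (heq.symm.trans h0.symm)]

theorem barycenter_eq_smul_sum {σ : Finset E} (h : σ.Nonempty) :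
    barycenter σ = (σ.card : ℝ)⁻¹ • ∑ v ∈ σ, v := by
  rw [barycenter, Finset.centroid_eq_centerMass _ h, Finset.centerMass_eq_of_sum_1 _ _
    (Finset.sum_centroidWeights_eq_one_of_nonempty ℝ σ h), Finset.smul_sum]
  simp

/-- Having maximal coordinates at all vertices of `ρ` is a convex condition, and the barycenter of
any `τ ⊇ ρ` satisfies it. -/
theorem exists_isWeight_of_mem_convexHull_flagSimplex {c : Finset (Finset E)} {M : Finset E}
    (hcM : ∀ τ ∈ c, τ ⊆ M) {ρ : Finset E} (hρ : ∀ τ ∈ c, ρ ⊆ τ) (hne : ρ.Nonempty) {x : E}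
    (hx : x ∈ convexHull ℝ (flagSimplex c : Set E)) :
    ∃ w, IsWeight M w ∧ (∀ a ∈ ρ, ∀ v, w v ≤ w a) ∧ ∑ v ∈ M, w v • v = x := by
  classical
  set P : Set E :=
    {x | ∃ w, IsWeight M w ∧ (∀ a ∈ ρ, ∀ v, w v ≤ w a) ∧ ∑ v ∈ M, w v • v = x} with hP
  refine convexHull_min (t := P) ?_ ?_ hx
  · intro y hy
    obtain ⟨τ, hτ, rfl⟩ := Finset.mem_image.1 (Finset.mem_coe.1 hy)
    have hτne : τ.Nonempty := hne.mono (hρ τ hτ)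
    have hcard : (0 : ℝ) < τ.card := Nat.cast_pos.2 hτne.card_pos
    have hwt : IsWeight τ fun v => if v ∈ τ then (τ.card : ℝ)⁻¹ else 0 := by
      refine ⟨fun v => ?_, fun v hv => if_neg hv, ?_⟩
      · split_ifs
        exacts [(inv_pos.2 hcard).le, le_rfl]
      · rw [Finset.sum_congr rfl fun v hv => if_pos hv, Finset.sum_const, nsmul_eq_mul,
          mul_inv_cancel₀ hcard.ne']
    refine ⟨_, hwt.mono (hcM τ hτ), fun a ha v => ?_, ?_⟩
    · rw [if_pos (hρ τ hτ ha)]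
      split_ifs
      exacts [le_rfl, (inv_pos.2 hcard).le]
    · rw [hwt.sum_smul_eq_of_subset (hcM τ hτ), barycenter_eq_smul_sum hτne, Finset.smul_sum]
      exact Finset.sum_congr rfl fun v hv => by rw [if_pos hv]
  · rintro _ ⟨w₁, h₁, hm₁, rfl⟩ _ ⟨w₂, h₂, hm₂, rfl⟩ s t hs ht hst
    refine ⟨fun v => s * w₁ v + t * w₂ v, ⟨fun v => ?_, fun v hv => ?_, ?_⟩, fun a ha v => ?_, ?_⟩
    · exact add_nonneg (mul_nonneg hs (h₁.nonneg v)) (mul_nonneg ht (h₂.nonneg v))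
    · simp [h₁.eq_zero v hv, h₂.eq_zero v hv]
    · rw [Finset.sum_add_distrib, ← Finset.mul_sum, ← Finset.mul_sum, h₁.sum_eq_one,
        h₂.sum_eq_one, mul_one, mul_one, hst]
    · exact add_le_add (mul_le_mul_of_nonneg_left (hm₁ a ha v) hs)
        (mul_le_mul_of_nonneg_left (hm₂ a ha v) ht)
    · simp only [add_smul, mul_smul, Finset.sum_add_distrib, ← Finset.smul_sum]

theorem IsFlag.exists_max {c : Finset (Finset E)} (hc : K.IsFlag c) (hne : c.Nonempty) :
    ∃ M ∈ c, ∀ τ ∈ c, τ ⊆ M := by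
  obtain ⟨M, hM, hmax⟩ := c.exists_max_image Finset.card hne
  refine ⟨M, hM, fun τ hτ => ?_⟩
  rcases hc.2.total (Finset.mem_coe.2 hτ) (Finset.mem_coe.2 hM) with h | h
  · exact h
  · exact (Finset.eq_of_subset_of_card_le h (hmax τ hτ)).ge

variable {ε : K.Cochain 0}

/-- A point of a simplex lies in `V_ε` if and only if its largest barycentric coordinate is
attained at vertices of both labels. -/
theorem sum_smul_mem_dualSpace_iff (hσ : σ ∈ K.faces) {w : E → ℝ} (hw : IsWeight σ w) :
    ∑ v ∈ σ, w v • v ∈ K.dualSpace ε ↔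
      ∃ a ∈ σ, ∃ b ∈ σ, K.label ε a ≠ K.label ε b ∧ w a = w b ∧ ∀ v, w v ≤ w a := by
  classical
  have hpos : ∀ a, (∀ v, w v ≤ w a) → 0 < w a := fun a ha => by
    by_contra h
    have h0 : ∑ v ∈ σ, w v ≤ 0 := Finset.sum_nonpos fun v _ => (ha v).trans (not_lt.1 h)
    rw [hw.sum_eq_one] at h0
    exact absurd h0 (by norm_num)
  have hmem : ∀ a, 0 < w a → a ∈ σ := fun a ha => by
    by_contra h
    exact ha.ne' (hw.eq_zero a h)
  constructor
  · intro hx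
    simp only [dualSpace, mem_iUnion] at hx
    obtain ⟨s, ⟨-, c, hc, ⟨σ₀, hσ₀, hmin, hcob⟩, hs⟩, hx⟩ := hx
    obtain ⟨a, ha, b, hb, hab⟩ := (coboundary_ne_zero_iff σ₀).1 hcob
    obtain ⟨M, hM, hmax⟩ := hc.exists_max ⟨_, hσ₀⟩
    obtain ⟨w', hw', hwa, heq⟩ := exists_isWeight_of_mem_convexHull_flagSimplex hmax hmin
      ⟨a, ha⟩ (convexHull_mono (Finset.coe_subset.2 hs) hx)
    obtain rfl := hw.eq_of_sum_smul_eq hσ (hc.1 hM) hw' heq.symm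
    exact ⟨a, hmem a (hpos a (hwa a ha)), b, hmem b (hpos b (hwa b hb)), hab,
      le_antisymm (hwa b hb a) (hwa a ha b), hwa a ha⟩
  · rintro ⟨a, ha, b, hb, hab, hwab, hmax⟩
    have hbmax : ∀ v, w v ≤ w b := fun v => hwab ▸ hmax v
    -- Every member of the chain contains the maximising vertices `a` and `b`, so the edge `{a, b}`
    -- can be put at the bottom to form the required flag.
    obtain ⟨c, l, hc, hcσ, hl, hwc⟩ := (σ.filter fun v => 0 < w v).exists_chain_decomposition w
      (fun v hv => (Finset.mem_filter.1 hv).2) (fun v hv => by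
        by_contra h
        have h1 := (hw.nonneg v).lt_of_ne' h
        exact hv (Finset.mem_filter.2 ⟨hmem v h1, h1⟩))
    have hτσ : ∀ τ ∈ c, τ ⊆ σ := fun τ hτ => (hcσ τ hτ).1.trans (Finset.filter_subset _ _)
    have habτ : ∀ τ ∈ c, {a, b} ⊆ τ := fun τ hτ => by
      rw [Finset.insert_subset_iff, Finset.singleton_subset_iff]
      exact ⟨(hcσ τ hτ).2 a hmax, (hcσ τ hτ).2 b hbmax⟩
    have hne : a ≠ b := fun h => hab (h ▸ rfl)
    have habσ : {a, b} ⊆ σ := by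
      rw [Finset.insert_subset_iff, Finset.singleton_subset_iff]
      exact ⟨ha, hb⟩
    have habK : {a, b} ∈ K.faces := K.down_closed hσ habσ (Finset.insert_nonempty a {b})
    have hτne : ∀ τ ∈ c, τ.Nonempty := fun τ hτ => (Finset.insert_nonempty a {b}).mono (habτ τ hτ)
    have hcne : c.Nonempty := by
      by_contra h
      rw [Finset.not_nonempty_iff_eq_empty] at h
      have h1 := hpos a hmax
      rw [hwc a, h, Finset.sum_empty] at h1
      exact lt_irrefl _ h1
    simp only [dualSpace, mem_iUnion]
    refine ⟨flagSimplex c, ⟨hcne.image _, insert {a, b} c, ⟨?_, ?_⟩,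
      ⟨⟨{a, b}, habK, Finset.card_pair hne⟩, Finset.mem_insert_self _ _, ?_, ?_⟩,
      Finset.image_subset_image (Finset.subset_insert _ _)⟩, ?_⟩
    · intro τ hτ
      rcases Finset.mem_insert.1 (Finset.mem_coe.1 hτ) with rfl | hτ
      · exact habK
      · exact K.down_closed hσ (hτσ τ hτ) (hτne τ hτ)
    · rw [Finset.coe_insert]
      exact hc.insert fun τ hτ _ => Or.inl (habτ τ hτ)
    · intro τ hτ
      rcases Finset.mem_insert.1 hτ with rfl | hτ
      · exact subset_rfl
      · exact habτ τ hτ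
    · exact (coboundary_ne_zero_iff _).2 ⟨a, by simp, b, by simp, hab⟩
    · have hcard : ∀ τ ∈ c, (τ.card : ℝ) ≠ 0 := fun τ hτ =>
        Nat.cast_ne_zero.2 (hτne τ hτ).card_pos.ne'
      -- The factor `τ.card` compensates the division in the barycenter; these coefficients sum to
      -- `1`, so the point is a convex combination of barycenters.
      have hx : ∑ v ∈ σ, w v • v = ∑ τ ∈ c, (l τ * τ.card) • barycenter τ := by
        have : ∀ v ∈ σ, w v • v = ∑ τ ∈ c, (if v ∈ τ then l τ else 0) • v := fun v _ => by
          rw [hwc v, Finset.sum_smul]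
        rw [Finset.sum_congr rfl this, Finset.sum_comm]
        refine Finset.sum_congr rfl fun τ hτ => ?_
        rw [barycenter_eq_smul_sum (hτne τ hτ), smul_smul, mul_assoc,
          mul_inv_cancel₀ (hcard τ hτ), mul_one, Finset.smul_sum]
        rw [← Finset.sum_subset (hτσ τ hτ) fun v _ hv => by rw [if_neg hv, zero_smul]]
        exact Finset.sum_congr rfl fun v hv => by rw [if_pos hv]
      have hsum : ∑ τ ∈ c, l τ * τ.card = 1 := by
        rw [← hw.sum_eq_one, Finset.sum_congr rfl fun v _ => hwc v, Finset.sum_comm]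
        refine Finset.sum_congr rfl fun τ hτ => ?_
        rw [← Finset.sum_subset (hτσ τ hτ) fun v _ hv => by rw [if_neg hv],
          Finset.sum_congr rfl fun v hv => if_pos hv, Finset.sum_const, nsmul_eq_mul, mul_comm]
      rw [hx]
      exact (convex_convexHull ℝ _).sum_mem
        (fun τ hτ => mul_nonneg (hl τ hτ) (Nat.cast_nonneg _)) hsum
        fun τ hτ => subset_convexHull ℝ _
          (Finset.mem_coe.2 (Finset.mem_image_of_mem _ hτ))

end Weights

end Geometry.SimplicialComplex

/-! ### Transport to the simplices of `K`: the isotopy and the cells. -/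

namespace Geometry.SimplicialComplex

open Classical in
/-- The extension by zero of a family of coefficients on the vertices of `σ`. -/
noncomputable def extendWeight {α : Type*} {σ : Finset α} (w : σ → ℝ) (v : α) : ℝ := if h : v ∈ σ then w ⟨v, h⟩ else 0

theorem extendWeight_coe {α : Type*} {σ : Finset α} (w : σ → ℝ) (v : σ) : extendWeight w v = w v := by
  simp [extendWeight]

theorem isWeight_extendWeight {α : Type*} {σ : Finset α} {w : σ → ℝ} (hw : w ∈ stdSimplex ℝ σ) :
    IsWeight σ (extendWeight w) := by
  refine ⟨fun v => ?_, fun v hv => dif_neg hv, ?_⟩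
  · unfold extendWeight
    split_ifs with h
    exacts [hw.1 _, le_rfl]
  · rw [← Finset.sum_coe_sort]
    simp only [extendWeight_coe]
    exact hw.2

theorem IsWeight.restrict_mem_stdSimplex {α : Type*} {σ : Finset α} {w : α → ℝ} (hw : IsWeight σ w) :
    (fun v : σ => w v) ∈ stdSimplex ℝ σ :=
  ⟨fun v => hw.nonneg v, (Finset.sum_coe_sort σ w).trans hw.sum_eq_one⟩

variable {E : Type u} [AddCommGroup E] [Module ℝ E] {K : SimplicialComplex ℝ E} {σ τ : Finset E}
  {ε : K.Cochain 0}

theorem sum_extendWeight_smul (w : σ → ℝ) :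
    ∑ v ∈ σ, extendWeight w v • v = ∑ v : σ, w v • (v : E) := by
  rw [← Finset.sum_coe_sort]
  simp only [extendWeight_coe]

/-- The barycentric parametrization of a simplex of `K`. -/
noncomputable def simplexEquiv (hσ : σ ∈ K.faces) :
    stdSimplex ℝ σ ≃ convexHull ℝ (σ : Set E) :=
  Equiv.ofBijective (fun w => ⟨∑ v : σ, w.1 v • (v : E), mem_convexHull_iff_exists_isWeight.2
      ⟨_, isWeight_extendWeight w.2, sum_extendWeight_smul w.1⟩⟩) <| by
    constructor
    · intro w w' h
      have h1 := congrArg Subtype.val h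
      simp only [← sum_extendWeight_smul] at h1
      have h2 := (isWeight_extendWeight w.2).eq_of_sum_smul_eq hσ hσ
        (isWeight_extendWeight w'.2) h1
      refine Subtype.ext (funext fun v => ?_)
      rw [← extendWeight_coe w.1, h2, extendWeight_coe]
    · rintro ⟨x, hx⟩
      obtain ⟨w, hw, rfl⟩ := mem_convexHull_iff_exists_isWeight.1 hx
      refine ⟨⟨_, hw.restrict_mem_stdSimplex⟩, Subtype.ext ?_⟩
      exact Finset.sum_coe_sort σ fun v => w v • v

theorem simplexEquiv_apply (hσ : σ ∈ K.faces) (w : stdSimplex ℝ σ) :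
    (simplexEquiv hσ w).1 = ∑ v : σ, w.1 v • (v : E) := rfl

theorem extendWeight_eq_of_simplexEquiv_eq (hσ : σ ∈ K.faces) (hτ : τ ∈ K.faces)
    {w : stdSimplex ℝ σ} {w' : stdSimplex ℝ τ}
    (h : (simplexEquiv hσ w).1 = (simplexEquiv hτ w').1) :
    extendWeight w.1 = extendWeight w'.1 := by
  rw [simplexEquiv_apply, simplexEquiv_apply, ← sum_extendWeight_smul,
    ← sum_extendWeight_smul] at h
  exact (isWeight_extendWeight w.2).eq_of_sum_smul_eq hσ hτ (isWeight_extendWeight w'.2) h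

/-- The point has a single extended weight: it is positive on all of `σ` and zero off `τ`. -/
theorem subset_of_simplexEquiv_eq (hσ : σ ∈ K.faces) (hτ : τ ∈ K.faces)
    {w : stdSimplex ℝ σ} {w' : stdSimplex ℝ τ} (hw : ∀ i, 0 < w.1 i)
    (h : (simplexEquiv hσ w).1 = (simplexEquiv hτ w').1) : σ ⊆ τ := by
  intro v hv
  by_contra hvτ
  have h1 := hw ⟨v, hv⟩
  rw [← extendWeight_coe w.1, extendWeight_eq_of_simplexEquiv_eq hσ hτ h, extendWeight,
    dif_neg hvτ] at h1
  exact lt_irrefl _ h1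

theorem exists_mem_convexHull_erase (hσ : σ ∈ K.faces) (w : stdSimplex ℝ σ) {i : σ}
    (hi : w.1 i = 0) : ∃ τ, τ ⊂ σ ∧ τ.Nonempty ∧
      (simplexEquiv hσ w).1 ∈ convexHull ℝ (τ : Set E) := by
  classical
  have hw := isWeight_extendWeight w.2
  have hi' : extendWeight w.1 i = 0 := by rw [extendWeight_coe, hi]
  have hsub : σ.erase i ⊂ σ := Finset.erase_ssubset i.2
  have hwt : IsWeight (σ.erase (i : E)) (extendWeight w.1) := by
    refine ⟨hw.nonneg, fun v hv => ?_, ?_⟩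
    · by_cases h : v = i
      · rw [h, hi']
      · exact hw.eq_zero v fun h' => hv (Finset.mem_erase.2 ⟨h, h'⟩)
    · rw [Finset.sum_erase _ hi', hw.sum_eq_one]
  refine ⟨_, hsub, ?_, mem_convexHull_iff_exists_isWeight.2 ⟨_, hwt, ?_⟩⟩
  · by_contra h
    have h1 := hwt.sum_eq_one
    rw [Finset.not_nonempty_iff_eq_empty.1 h, Finset.sum_empty] at h1
    exact zero_ne_one h1
  · rw [simplexEquiv_apply, ← sum_extendWeight_smul, hwt.sum_smul_eq_of_subset hsub.1]

/-- The vertices of `σ` with label `1`. -/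
def labelOne (K : SimplicialComplex ℝ E) (ε : K.Cochain 0) (σ : Finset E) : Set σ :=
  {v | K.label ε v = 1}

theorem simplexEquiv_mem_dualSpace_iff (hσ : σ ∈ K.faces) (w : stdSimplex ℝ σ) :
    (simplexEquiv hσ w).1 ∈ K.dualSpace ε ↔
      ‖(K.labelOne ε σ).indicator w.1‖ = ‖(K.labelOne ε σ)ᶜ.indicator w.1‖ := by
  have hz : ∀ x y : ZMod 2, x ≠ y → (x = 1 ∧ y ≠ 1) ∨ (y = 1 ∧ x ≠ 1) := by decide
  rw [simplexEquiv_apply, ← sum_extendWeight_smul,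
    sum_smul_mem_dualSpace_iff hσ (isWeight_extendWeight w.2),
    norm_indicator_eq_iff_exists_isMax _ w.2]
  constructor
  · rintro ⟨a, ha, b, hb, hab, hwab, hmax⟩
    have h1 := extendWeight_coe w.1 ⟨a, ha⟩
    have h2 := extendWeight_coe w.1 ⟨b, hb⟩
    simp only at h1 h2
    have hmax' : ∀ i, w.1 i ≤ w.1 ⟨a, ha⟩ := fun i => by
      rw [← extendWeight_coe w.1 i, ← h1]
      exact hmax i
    rw [h1, h2] at hwab
    rcases hz _ _ hab with ⟨ha1, hb1⟩ | ⟨hb1, ha1⟩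
    · exact ⟨⟨a, ha⟩, ha1, ⟨b, hb⟩, hb1, hwab, hmax'⟩
    · exact ⟨⟨b, hb⟩, hb1, ⟨a, ha⟩, ha1, hwab.symm, fun i => hwab ▸ hmax' i⟩
  · rintro ⟨a, ha, b, hb, hwab, hmax⟩
    refine ⟨a, a.2, b, b.2, fun h => hb ?_, ?_, fun v => ?_⟩
    · exact h.symm.trans ha
    · rw [extendWeight_coe, extendWeight_coe, hwab]
    · rw [extendWeight_coe]
      unfold extendWeight
      split_ifs with h
      exacts [hmax _, w.2.1 a]

theorem not_isConstOn_of_nonempty (hσ : σ ∈ K.faces)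
    (h : (K.dualSpace ε ∩ convexHull ℝ (σ : Set E)).Nonempty) : ¬ K.IsConstOn ε σ := by
  obtain ⟨x, hx, hxσ⟩ := h
  obtain ⟨w, hw, rfl⟩ := mem_convexHull_iff_exists_isWeight.1 hxσ
  obtain ⟨a, ha, b, hb, hab, -⟩ := (sum_smul_mem_dualSpace_iff hσ hw).1 hx
  exact fun hc => hab ((isConstOn_iff_label hσ).1 hc a ha b hb)

theorem exists_card_eq_of_not_isConstOn {σ : Finset E} (hσ : σ ∈ K.faces)
    (hε : ¬ K.IsConstOn ε σ) : ∃ m, σ.card = m + 1 + 1 := by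
  rw [isConstOn_iff_label hσ] at hε
  push Not at hε
  obtain ⟨a, ha, b, hb, hab⟩ := hε
  have := Finset.one_lt_card.2 ⟨a, ha, b, hb, fun h => hab (h ▸ rfl)⟩
  exact ⟨σ.card - 2, by omega⟩

/-- By affine independence an affine function may take the values `1` and `-1` on the two label
classes. -/
theorem exists_separates (hσ : σ ∈ K.faces) : ∃ f : E →ᵃ[ℝ] ℝ, K.Separates ε σ f := by
  classical
  obtain ⟨f, hf⟩ := (K.indep hσ).exists_affineMap_apply_eq
    fun v => if K.label ε v = 1 then 1 else -1
  refine ⟨f, (separates_iff_label hσ).2 fun v hv => ?_⟩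
  have h := hf ⟨v, hv⟩
  simp only at h
  rw [h]
  constructor
  · intro h1
    simp [h1]
  · intro h0
    simp [h0]

theorem affineMap_simplexEquiv (hσ : σ ∈ K.faces) (f : E →ᵃ[ℝ] ℝ) (w : stdSimplex ℝ σ) :
    f (simplexEquiv hσ w).1 = ∑ v : σ, f v * w.1 v := by
  rw [simplexEquiv_apply, f.decomp]
  simp only [Pi.add_apply, map_sum, map_smul, smul_eq_mul, add_mul, Finset.sum_add_distrib,
    ← Finset.mul_sum]
  rw [w.2.2, mul_one]
  simp only [mul_comm]

/-- The relatively open simplex with vertex set `σ`. -/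
def openSimplex (hσ : σ ∈ K.faces) : Set K.Polyhedron :=
  {x | ∃ w : stdSimplex ℝ σ, (∀ i, 0 < w.1 i) ∧ (simplexEquiv hσ w).1 = x.1}

theorem disjoint_openSimplex (hσ : σ ∈ K.faces) (hτ : τ ∈ K.faces) (h : σ ≠ τ) :
    Disjoint (K.openSimplex hσ) (K.openSimplex hτ) := by
  rw [Set.disjoint_left]
  rintro x ⟨w, hw, hx⟩ ⟨w', hw', hx'⟩
  exact h ((subset_of_simplexEquiv_eq hσ hτ hw (hx.trans hx'.symm)).antisymm
    (subset_of_simplexEquiv_eq hτ hσ hw' (hx'.trans hx.symm)))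

section Topology

variable [TopologicalSpace E]

theorem continuous_simplexInclusion (σ : K.faces) : Continuous (K.simplexInclusion σ) :=
  continuous_iff_coinduced_le.2
    (le_iSup (fun σ : K.faces => TopologicalSpace.coinduced (K.simplexInclusion σ) inferInstance) σ)

variable [IsTopologicalAddGroup E] [ContinuousSMul ℝ E]

theorem continuous_simplexEquiv (hσ : σ ∈ K.faces) : Continuous (simplexEquiv hσ) :=
  Continuous.subtype_mk (continuous_finsetSum _ fun v _ =>
    ((continuous_apply v).comp continuous_subtype_val).smul continuous_const) _

/-- The intersection of `V_ε` with a simplex is a cell. -/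
theorem exists_cell_parametrization {p : ℕ} (hσ : σ ∈ K.faces) (hcard : σ.card = p + 1 + 1)
    (hε : ¬ K.IsConstOn ε σ) :
    ∃ Φ : (Fin p → ℝ) → K.Polyhedron, ContinuousOn Φ (Metric.closedBall 0 1) ∧
      InjOn Φ (Metric.closedBall 0 1) ∧
      Φ '' Metric.closedBall 0 1 = K.dualSubset ε ∩ K.closedSimplex σ ∧
      Φ '' Metric.ball 0 1 = K.dualSubset ε ∩ K.openSimplex hσ := by
  classical
  have hz : ∀ x y : ZMod 2, x ≠ y → (x = 1 ∧ y ≠ 1) ∨ (y = 1 ∧ x ≠ 1) := by decide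
  set T := K.labelOne ε σ with hT
  obtain ⟨a, b, ha, hb⟩ : ∃ a b, a ∈ T ∧ b ∉ T := by
    rw [isConstOn_iff_label hσ] at hε
    push Not at hε
    obtain ⟨a, ha, b, hb, hab⟩ := hε
    rcases hz _ _ hab with h | h
    exacts [⟨⟨a, ha⟩, ⟨b, hb⟩, h⟩, ⟨⟨b, hb⟩, ⟨a, ha⟩, h⟩]
  obtain ⟨g, hgc, hginj, hgclosed, hgopen⟩ := exists_closedBall_parametrization
    (p := p) (by rw [Fintype.card_coe, hcard]) ha hb
  -- With unit weights the time 1 map sends `V_ε ∩ σ` onto the half-mass slice, already parametrised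
  -- by a ball.
  have hF : ∀ i, 0 < (1 : σ → ℝ) i := fun _ => one_pos
  have hgmem : ∀ u ∈ Metric.closedBall (0 : Fin p → ℝ) 1, g u ∈ stdSimplex ℝ σ ∧
      ∑ i, (T.indicator 1 i - Tᶜ.indicator 1 i) * g u i = 0 := fun u hu =>
    hgclosed.subset (mem_image_of_mem g hu)
  let h := isotopyHomeo hF T 1
  let ψ : Metric.closedBall (0 : Fin p → ℝ) 1 → K.Polyhedron := fun u =>
    K.simplexInclusion ⟨σ, hσ⟩ (simplexEquiv hσ (h.symm ⟨g u.1, (hgmem u.1 u.2).1⟩))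
  have hψc : Continuous ψ := (continuous_simplexInclusion _).comp ((continuous_simplexEquiv hσ).comp
    (h.symm.continuous.comp (Continuous.subtype_mk (hgc.comp continuous_subtype_val) _)))
  have hψinj : Function.Injective ψ := fun u v huv => by
    have h1 : simplexEquiv hσ (h.symm ⟨g u.1, (hgmem u.1 u.2).1⟩) =
        simplexEquiv hσ (h.symm ⟨g v.1, (hgmem v.1 v.2).1⟩) :=
      Subtype.ext (congrArg (fun x : K.Polyhedron => x.1) huv)
    have h2 := h.symm.injective ((simplexEquiv hσ).injective h1)
    exact Subtype.ext (hginj (congrArg Subtype.val h2))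
  have hV : ∀ w, (simplexEquiv hσ w).1 ∈ K.dualSpace ε ↔
      ∑ i, (T.indicator 1 i - Tᶜ.indicator 1 i) * (h w).1 i = 0 := fun w => by
    rw [simplexEquiv_mem_dualSpace_iff hσ, ← sum_mul_isotopyHomeo_one_eq_zero_iff hF]
  -- The isotopy preserves the zero coordinates, so the open ball corresponds to the open simplex.
  have hpos : ∀ w, (∀ i, 0 < (h w).1 i) ↔ ∀ i, 0 < w.1 i := fun w => forall_congr' fun i => by
    have h1 := isotopyHomeo_apply_eq_zero_iff hF T 1 w i
    rw [((h w).2.1 i).lt_iff_ne', (w.2.1 i).lt_iff_ne']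
    exact not_congr h1
  have h0 : (0 : Fin p → ℝ) ∈ Metric.closedBall (0 : Fin p → ℝ) 1 := by simp
  -- Outside the closed ball the value is irrelevant; a constant makes the map total.
  let Φ : (Fin p → ℝ) → K.Polyhedron := fun u =>
    if hu : u ∈ Metric.closedBall (0 : Fin p → ℝ) 1 then ψ ⟨u, hu⟩ else ψ ⟨0, h0⟩
  have hΦ : ∀ u (hu : u ∈ Metric.closedBall (0 : Fin p → ℝ) 1), Φ u = ψ ⟨u, hu⟩ :=
    fun u hu => dif_pos hu
  have hball := Metric.ball_subset_closedBall (x := (0 : Fin p → ℝ)) (ε := 1)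
  have hval : ∀ u (hu : u ∈ Metric.closedBall (0 : Fin p → ℝ) 1),
      (Φ u).1 = (simplexEquiv hσ (h.symm ⟨g u, (hgmem u hu).1⟩)).1 := fun u hu => by
    rw [hΦ u hu]
    rfl
  have hΦV : ∀ u ∈ Metric.closedBall (0 : Fin p → ℝ) 1, Φ u ∈ K.dualSubset ε := fun u hu => by
    change (Φ u).1 ∈ K.dualSpace ε
    rw [hval u hu, hV, h.apply_symm_apply]
    exact (hgmem u hu).2
  have hlift : ∀ (x : K.Polyhedron) (w : stdSimplex ℝ σ) (u : Fin p → ℝ),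
      u ∈ Metric.closedBall (0 : Fin p → ℝ) 1 → g u = (h w).1 → (simplexEquiv hσ w).1 = x.1 →
      Φ u = x := fun x w u hu hgu hx => by
    apply Subtype.ext
    rw [hval u hu, ← hx]
    congr 2
    rw [Homeomorph.symm_apply_eq]
    exact Subtype.ext hgu
  refine ⟨Φ, ?_, ?_, ?_, ?_⟩
  · rw [continuousOn_iff_continuous_domRestrict]
    exact hψc.congr fun u => (hΦ u.1 u.2).symm
  · intro u hu v hv huv
    rw [hΦ u hu, hΦ v hv] at huv
    exact congrArg Subtype.val (hψinj huv)
  · ext x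
    constructor
    · rintro ⟨u, hu, rfl⟩
      refine ⟨hΦV u hu, ?_⟩
      change (Φ u).1 ∈ convexHull ℝ (σ : Set E)
      rw [hval u hu]
      exact Subtype.coe_prop _
    · rintro ⟨hxV, hxσ⟩
      obtain ⟨w, hw⟩ := (simplexEquiv hσ).surjective ⟨x.1, hxσ⟩
      have hwx : (simplexEquiv hσ w).1 = x.1 := congrArg Subtype.val hw
      have hwV := (hV w).1 (hwx ▸ hxV)
      obtain ⟨u, hu, hgu⟩ := hgclosed.superset ⟨(h w).2, hwV⟩
      exact ⟨u, hu, hlift x w u hu hgu hwx⟩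
  · ext x
    constructor
    · rintro ⟨u, hu, rfl⟩
      refine ⟨hΦV u (hball hu), h.symm ⟨g u, (hgmem u (hball hu)).1⟩, ?_,
        (hval u (hball hu)).symm⟩
      rw [← hpos, h.apply_symm_apply]
      exact (hgopen.subset (mem_image_of_mem g hu)).2.2
    · rintro ⟨hxV, w, hw, hwx⟩
      have hwV := (hV w).1 (hwx ▸ hxV)
      obtain ⟨u, hu, hgu⟩ := hgopen.superset ⟨(h w).2, hwV, (hpos w).2 hw⟩
      exact ⟨u, hu, hlift x w u (hball hu) hgu hwx⟩

variable [T2Space E]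

/-- The barycentric parametrization of a simplex of `K`, as a homeomorphism. -/
noncomputable def simplexHomeo (hσ : σ ∈ K.faces) :
    stdSimplex ℝ σ ≃ₜ convexHull ℝ (σ : Set E) :=
  haveI : CompactSpace (stdSimplex ℝ σ) := isCompact_iff_compactSpace.1 (isCompact_stdSimplex ℝ σ)
  Continuous.homeoOfEquivCompactToT2 (f := simplexEquiv hσ) (continuous_simplexEquiv hσ)

theorem simplexHomeo_apply (hσ : σ ∈ K.faces) (w : stdSimplex ℝ σ) :
    simplexHomeo hσ w = simplexEquiv hσ w := rfl

/-- Separation says that `f` is `|f|` on label 1 and `-|f|` on label 0, so the isotopy with `F =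
|f|` applies, conjugated by the barycentric parametrization. -/
theorem isotopicWithin_of_separates (hσ : σ ∈ K.faces) {f : E →ᵃ[ℝ] ℝ}
    (hf : K.Separates ε σ f) :
    IsotopicWithin {x : convexHull ℝ (σ : Set E) | x.1 ∈ K.dualSpace ε}
      {x : convexHull ℝ (σ : Set E) | f x.1 = 0} := by
  have hz : ∀ x : ZMod 2, x ≠ 1 → x = 0 := by decide
  rw [separates_iff_label hσ] at hf
  set T := K.labelOne ε σ with hT
  have hF : ∀ v : σ, 0 < |f v| := fun v => by
    by_cases h : K.label ε v = 1
    · exact abs_pos_of_pos ((hf v v.2).1 h)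
    · exact abs_pos_of_neg ((hf v v.2).2 (hz _ h))
  have hfF : ∀ v : σ, T.indicator (fun v : σ => |f v|) v - Tᶜ.indicator (fun v : σ => |f v|) v =
      f v := fun v => by
    by_cases h : v ∈ T
    · have h' : v ∉ Tᶜ := fun h' => h' h
      rw [indicator_of_mem h, indicator_of_notMem h', sub_zero,
        abs_of_pos ((hf v v.2).1 h)]
    · have h' : v ∈ Tᶜ := h
      rw [indicator_of_notMem h, indicator_of_mem h', zero_sub,
        abs_of_neg ((hf v v.2).2 (hz _ h)), neg_neg]
  let φ := simplexHomeo hσ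
  let H := fun t => φ.symm.trans ((isotopyHomeo hF T t).trans φ)
  have hiff : ∀ x, x.1 ∈ K.dualSpace ε ↔ f (H 1 x).1 = 0 := fun x => by
    obtain ⟨w, rfl⟩ := φ.surjective x
    have h1 : H 1 (φ w) = φ (isotopyHomeo hF T 1 w) := by
      simp [H]
    rw [h1, simplexHomeo_apply, simplexHomeo_apply, simplexEquiv_mem_dualSpace_iff,
      affineMap_simplexEquiv, ← sum_mul_isotopyHomeo_one_eq_zero_iff hF]
    simp only [← hT, hfF]
  refine ⟨H, ?_, ?_, ?_⟩
  · exact φ.continuous.comp ((continuous_isotopyEquiv hF T).comp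
      (continuous_fst.prodMk (φ.symm.continuous.comp continuous_snd)))
  · refine Homeomorph.ext fun x => ?_
    simp [H, isotopyHomeo_zero]
  · ext y
    constructor
    · rintro ⟨x, hx, rfl⟩
      exact (hiff x).1 hx
    · intro hy
      refine ⟨(H 1).symm y, (hiff _).2 ?_, (H 1).apply_symm_apply y⟩
      rw [(H 1).apply_symm_apply]
      exact hy

end Topology

end Geometry.SimplicialComplex

/-! ### The CW structure. -/

/-- A continuous injection of a compact set into a Hausdorff space is an embedding, and so is its
restriction to `t`; used with `s` the closed and `t` the open ball. -/
theorem exists_partialEquiv_of_injOn_compact {X Y : Type*} [TopologicalSpace X]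
    [TopologicalSpace Y] [T2Space Y] [Nonempty X] {s t : Set X} (hs : IsCompact s) (hts : t ⊆ s)
    {f : X → Y} (hf : ContinuousOn f s) (hinj : InjOn f s) :
    ∃ e : PartialEquiv X Y, ⇑e = f ∧ e.source = t ∧ ContinuousOn e.symm e.target := by
  have : CompactSpace s := isCompact_iff_compactSpace.1 hs
  have hemb : IsEmbedding (s.domRestrict f) :=
    (Continuous.isClosedEmbedding (continuousOn_iff_continuous_domRestrict.1 hf)
      (injOn_iff_injective.1 hinj)).isEmbedding
  have hemb' : IsEmbedding (t.domRestrict f) := hemb.comp (IsEmbedding.inclusion hts)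
  refine ⟨(hinj.mono hts).toPartialEquiv f t, rfl, rfl, ?_⟩
  set e := (hinj.mono hts).toPartialEquiv f t with he
  have hmaps : ∀ y : e.target, e.symm y ∈ t := fun y => e.map_target y.2
  rw [continuousOn_iff_continuous_domRestrict]
  have : Continuous fun y : e.target => (⟨e.symm y, hmaps y⟩ : t) := by
    rw [hemb'.isInducing.continuous_iff]
    exact continuous_subtype_val.congr fun y => (e.right_inv y.2).symm
  exact continuous_subtype_val.comp this

namespace Geometry.SimplicialComplex

variable {E : Type u} [AddCommGroup E] [Module ℝ E] [TopologicalSpace E]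
  [IsTopologicalAddGroup E] [ContinuousSMul ℝ E] [T2Space E]
  {K : SimplicialComplex ℝ E} {ε : K.Cochain 0}

theorem exists_cell_partialEquiv {p : ℕ} {σ : Finset E} (hσ : σ ∈ K.faces)
    (hcard : σ.card = p + 1 + 1) (hε : ¬ K.IsConstOn ε σ) :
    ∃ e : PartialEquiv (Fin p → ℝ) K.Polyhedron, e.source = Metric.ball 0 1 ∧
      ContinuousOn e (Metric.closedBall 0 1) ∧ ContinuousOn e.symm e.target ∧
      e '' Metric.closedBall 0 1 = K.dualSubset ε ∩ K.closedSimplex σ ∧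
      e '' Metric.ball 0 1 = K.dualSubset ε ∩ K.openSimplex hσ ∧
      ∀ u ∈ Metric.sphere (0 : Fin p → ℝ) 1, e u ∉ K.openSimplex hσ := by
  obtain ⟨Φ, hc, hinj, hclosed, hopen⟩ := exists_cell_parametrization hσ hcard hε
  obtain ⟨e, rfl, hsource, hsymm⟩ := exists_partialEquiv_of_injOn_compact
    (isCompact_closedBall _ _) Metric.ball_subset_closedBall hc hinj
  refine ⟨e, hsource, hc, hsymm, hclosed, hopen, fun u hu h => ?_⟩
  have hu' := Metric.sphere_subset_closedBall hu
  obtain ⟨v, hv, hvu⟩ := hopen.superset ⟨(hclosed.subset (mem_image_of_mem e hu')).1, h⟩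
  rw [hinj (Metric.ball_subset_closedBall hv) hu' hvu, Metric.mem_ball, Metric.mem_sphere.1 hu]
    at hv
  exact lt_irrefl _ hv

/-- `V_ε` has the structure of a CW complex whose closed cells are its intersections with the
simplices on which `ε` is not constant. -/
theorem exists_cwComplex_dualSubset (K : SimplicialComplex ℝ E) (ε : K.Cochain 0) :
    ∃ (_ : Topology.CWComplex (K.dualSubset ε))
      (e : ∀ p : ℕ, Topology.CWComplex.cell (K.dualSubset ε) p ≃
        {σ : K.Simplices (p + 1) // ¬ K.IsConstOn ε σ.1}),
      ∀ (p : ℕ) (c : Topology.CWComplex.cell (K.dualSubset ε) p),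
        Topology.CWComplex.closedCell (C := K.dualSubset ε) p c =
          K.dualSubset ε ∩ K.closedSimplex (e p c).1.1 := by
  classical
  choose m hsource hcont hsymm hclosed hopen hsphere using
    fun (p : ℕ) (c : {σ : K.Simplices (p + 1) // ¬ K.IsConstOn ε σ.1}) =>
      exists_cell_partialEquiv c.1.2.1 c.1.2.2 c.2
  have hcell : ∀ {σ : Finset E}, σ ∈ K.faces → ∀ {x : K.Polyhedron}, x ∈ K.dualSubset ε →
      x ∈ K.closedSimplex σ → ¬ K.IsConstOn ε σ := fun hσ x hx hxσ =>
    not_isConstOn_of_nonempty hσ ⟨x.1, hx, hxσ⟩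
  refine ⟨{ cell := fun p => {σ : K.Simplices (p + 1) // ¬ K.IsConstOn ε σ.1}
            map := m
            source_eq := hsource
            continuousOn := hcont
            continuousOn_symm := hsymm
            pairwiseDisjoint' := ?_
            mapsTo' := ?_
            closed' := ?_
            union' := ?_ }, fun p => Equiv.refl _, fun p c => hclosed p c⟩
  · rintro ⟨p, c⟩ - ⟨q, d⟩ - hne
    change Disjoint (m p c '' Metric.ball 0 1) (m q d '' Metric.ball 0 1)
    rw [hopen, hopen]
    refine (disjoint_openSimplex c.1.2.1 d.1.2.1 fun h => hne ?_).mono inter_subset_right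
      inter_subset_right
    -- The dimension of a cell is determined by the number of vertices of its simplex.
    have hpq : p = q := by
      have h1 := c.1.2.2
      have h2 := d.1.2.2
      rw [h, h2] at h1
      omega
    subst hpq
    rw [Subtype.ext (Subtype.ext h)]
  · intro p c
    have hfin : ∀ q, {d : {σ : K.Simplices (q + 1) // ¬ K.IsConstOn ε σ.1} |
        d.1.1 ⊆ c.1.1}.Finite := fun q =>
      Set.Finite.of_finite_image (f := fun d => d.1.1)
        ((c.1.1.powerset.finite_toSet).subset (by
          rintro _ ⟨d, hd, rfl⟩
          exact Finset.mem_coe.2 (Finset.mem_powerset.2 hd)))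
        fun d _ d' _ h => Subtype.ext (Subtype.ext h)
    -- The boundary is covered by the finitely many cells of faces of the simplex. A sphere point
    -- misses the open simplex, so a coordinate vanishes and the point lies in a proper face, which
    -- meets `V_ε` and so carries a cell of lower dimension.
    refine ⟨fun q => (hfin q).toFinset, fun u hu => ?_⟩
    obtain ⟨hxV, hxσ⟩ := (hclosed p c).subset
      (mem_image_of_mem (m p c) (Metric.sphere_subset_closedBall hu))
    obtain ⟨w, hw⟩ := (simplexEquiv c.1.2.1).surjective ⟨_, hxσ⟩
    have hw' : (simplexEquiv c.1.2.1 w).1 = (m p c u).1 := congrArg Subtype.val hw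
    obtain ⟨i, hi⟩ : ∃ i, w.1 i = 0 := by
      by_contra! h
      exact hsphere p c u hu ⟨w, fun i => (w.2.1 i).lt_of_ne' (h i), hw'⟩
    obtain ⟨τ, hτσ, hτne, hτ⟩ := exists_mem_convexHull_erase c.1.2.1 w hi
    rw [hw'] at hτ
    have hτK := K.down_closed c.1.2.1 hτσ.1 hτne
    have hτε := hcell hτK hxV hτ
    obtain ⟨q, hq⟩ := exists_card_eq_of_not_isConstOn hτK hτε
    have hqp : q < p := by
      have h1 := Finset.card_lt_card hτσ
      rw [hq, c.1.2.2] at h1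
      omega
    simp only [mem_iUnion]
    refine ⟨q, hqp, ⟨⟨τ, hτK, hq⟩, hτε⟩, (hfin q).mem_toFinset.2 hτσ.1, ?_⟩
    rw [hclosed]
    exact ⟨hxV, hτ⟩
  -- By coherence closedness is tested simplex by simplex: `A ⊆ V_ε` misses simplices with constant
  -- label, and on any other its trace is its intersection with one closed cell.
  · intro A hA hAc
    rw [isClosed_polyhedron_iff]
    rintro ⟨σ, hσ⟩
    by_cases hε : K.IsConstOn ε σ
    · have : K.simplexInclusion ⟨σ, hσ⟩ ⁻¹' A = ∅ := by
        refine eq_empty_of_forall_notMem fun x hx => hcell hσ (hA hx) ?_ hε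
        exact x.2
      rw [this]
      exact isClosed_empty
    · obtain ⟨p, hp⟩ := exists_card_eq_of_not_isConstOn hσ hε
      have h1 := (hAc p ⟨⟨σ, hσ, hp⟩, hε⟩).preimage (continuous_simplexInclusion ⟨σ, hσ⟩)
      rw [hclosed] at h1
      convert h1 using 1
      ext x
      exact ⟨fun hx => ⟨hx, hA hx, x.2⟩, fun hx => hx.1⟩
  · ext x
    simp only [mem_iUnion, hclosed]
    constructor
    · rintro ⟨p, c, hx, -⟩
      exact hx
    · intro hx
      obtain ⟨σ, hσ, hxσ⟩ := mem_space_iff.1 x.2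
      have hε := hcell hσ hx hxσ
      obtain ⟨p, hp⟩ := exists_card_eq_of_not_isConstOn hσ hε
      exact ⟨p, ⟨⟨σ, hσ, hp⟩, hε⟩, hx, hxσ⟩

end Geometry.SimplicialComplex

theorem mainTheorem9 {E : Type u} [AddCommGroup E] [Module ℝ E] [TopologicalSpace E]
    [IsTopologicalAddGroup E] [ContinuousSMul ℝ E] [T2Space E]
    (K : Geometry.SimplicialComplex ℝ E) (hK : K.IsLocallyFinite) (ε : K.Cochain 0) :
    (∀ σ ∈ K.faces, (K.dualSpace ε ∩ convexHull ℝ (σ : Set E)).Nonempty →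
      (∃ f : E →ᵃ[ℝ] ℝ, K.Separates ε σ f) ∧
      ∀ f : E →ᵃ[ℝ] ℝ, K.Separates ε σ f →
        IsotopicWithin {x : convexHull ℝ (σ : Set E) | x.1 ∈ K.dualSpace ε}
          {x : convexHull ℝ (σ : Set E) | f x.1 = 0}) ∧
    ∃ (_ : Topology.CWComplex (K.dualSubset ε))
      (e : ∀ p : ℕ, Topology.CWComplex.cell (K.dualSubset ε) p ≃
        {σ : K.Simplices (p + 1) // ¬ K.IsConstOn ε σ.1}),
      ∀ (p : ℕ) (c : Topology.CWComplex.cell (K.dualSubset ε) p),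
        Topology.CWComplex.closedCell (C := K.dualSubset ε) p c =
          K.dualSubset ε ∩ K.closedSimplex (e p c).1.1 :=
  ⟨fun _ hσ _ => ⟨Geometry.SimplicialComplex.exists_separates hσ,
    fun _ hf => Geometry.SimplicialComplex.isotopicWithin_of_separates hσ hf⟩,
    K.exists_cwComplex_dualSubset ε⟩
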